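/- Let $G_1=\{[x,a]:x\in\mathbb R,\ a\in\mathbb R\setminus\{0\}\}$ be the group of invertible affine transformations of the line, where $[x,a]$ denotes the map $z\mapsto x+az$. The group law is composition, $[x,a][y,b]=[x+ay,ab]$, and $G_1$ carries the topology of $\mathbb R\times(\mathbb R\setminus\{0\})$, which makes it a locally compact group. Let $\mu$ be a left Haar measure on $G_1$, and let $\lambda_{G_1}$ be the left regular representation of $G_1$ on $L^2(G_1,\mu)$, $\lambda_{G_1}(g)f(h)=f(g^{-1}h)$. Let $\rho$ be the natural (unitary) representation of $G_1$ on $L^2(\mathbb R)$, $\rho[x,a]f(y)=|a|^{-1/2}f\big(a^{-1}(y-x)\big)$ for a.e. $y\in\mathbb R$. Let $\aleph_0\cdot\rho$ denote the Hilbert space direct sum of countably infinitely many copies of $\rho$. Then: 1. $\lambda_{G_1}$ is unitarily equivalent to $\aleph_0\cdot\rho$, that is, there is a unitary map $U:L^2(G_1,\mu)\to\bigoplus_{j\in\mathbb N}L^2(\mathbb R)$ with $U\lambda_{G_1}(g)=\big(\bigoplus_{j\in\mathbb N}\rho(g)\big)U$ for all $g\in G_1$. 2. $\rho$ is square-integrable,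 that is, $\{0\}$ and $L^2(\mathbb R)$ are the only closed $\rho$-invariant subspaces of $L^2(\mathbb R)$, and there is a nonzero $\eta\in L^2(\mathbb R)$ such that the function $g\mapsto\langle\eta,\rho(g)\eta\rangle$ belongs to $L^2(G_1,\mu)$. -/

import Mathlib

open MeasureTheory

noncomputable section

/-! ### Unitary representations of topological groups -/

/-- A unitary representation of the topological group `G` on the complex Hilbert space `H`: a
homomorphism `π` into the unitary group of `H` such that `x ↦ ⟨ξ, π(x) η⟩` is continuous for all
`ξ, η`. (The inner product of Mathlib is linear in its second argument, so the number
`⟨ξ, π(x) η⟩` of an inner product that is linear in its first argument is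
`inner ℂ (π x η) ξ`.) -/
structure UnitaryRep (G : Type*) [Group G] [TopologicalSpace G]
    (H : Type*) [NormedAddCommGroup H] [InnerProductSpace ℂ H] [CompleteSpace H] where
  /-- the underlying homomorphism into the group of unitary operators -/
  toHom : G →* (H ≃ₗᵢ[ℂ] H)
  continuous_inner : ∀ ξ η : H, Continuous fun x : G => inner ℂ (toHom x η) ξ

namespace UnitaryRep

variable {G : Type*} [Group G] [TopologicalSpace G]

section Basic

variable {H : Type*} [NormedAddCommGroup H] [InnerProductSpace ℂ H] [CompleteSpace H]
  {K : Type*} [NormedAddCommGroup K] [InnerProductSpace ℂ K] [CompleteSpace K]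

/-- A multiplicative, weakly continuous family of linear isometries is a unitary
representation. -/
def ofIsometries (T : G → H →ₗᵢ[ℂ] H) (h1 : ∀ ξ, T 1 ξ = ξ)
    (hmul : ∀ x y ξ, T (x * y) ξ = T x (T y ξ))
    (hc : ∀ ξ η : H, Continuous fun x : G => inner ℂ (T x η) ξ) : UnitaryRep G H where
  toHom :=
    { toFun := fun x =>
        { toLinearEquiv := LinearEquiv.ofLinearMap (T x).toLinearMap (T x⁻¹).toLinearMap
            (by ext ξ; simp [← hmul, h1]) (by ext ξ; simp [← hmul, h1])
          norm_map' := fun ξ => (T x).norm_map ξ }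
      map_one' := by ext ξ; exact h1 ξ
      map_mul' := fun x y => by ext ξ; exact hmul x y ξ }
  continuous_inner := hc

@[simp]
theorem ofIsometries_apply (T : G → H →ₗᵢ[ℂ] H) (h1 : ∀ ξ, T 1 ξ = ξ)
    (hmul : ∀ x y ξ, T (x * y) ξ = T x (T y ξ))
    (hc : ∀ ξ η : H, Continuous fun x : G => inner ℂ (T x η) ξ) (x : G) (ξ : H) :
    (ofIsometries T h1 hmul hc).toHom x ξ = T x ξ := rfl

/-- Unitary equivalence: there is a unitary map that intertwines the two representations. -/
def Equivalent (σ : UnitaryRep G H) (π : UnitaryRep G K) : Prop :=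
  ∃ U : H ≃ₗᵢ[ℂ] K, ∀ (x : G) (ξ : H), U (σ.toHom x ξ) = π.toHom x (U ξ)

/-- A representation on a nonzero Hilbert space is irreducible if the zero space and the whole
space are the only closed invariant subspaces. -/
def IsIrreducible (π : UnitaryRep G H) : Prop :=
  Nontrivial H ∧ ∀ S : Submodule ℂ H, IsClosed (S : Set H) →
    (∀ (x : G), ∀ ξ ∈ S, π.toHom x ξ ∈ S) → S = ⊥ ∨ S = ⊤

/-- The coefficient function `V_η ξ : x ↦ ⟨ξ, π(x) η⟩`. -/
def coeff (π : UnitaryRep G H) (η ξ : H) (x : G) : ℂ := inner ℂ (π.toHom x η) ξ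

/-- `π` is square-integrable, with respect to the (left Haar) measure `μ` on `G`, if it is
irreducible and `V_η η ∈ L²(G, μ)` for some nonzero vector `η`. -/
def IsSquareIntegrable [MeasurableSpace G] (μ : Measure G) (π : UnitaryRep G H) : Prop :=
  π.IsIrreducible ∧ ∃ η : H, η ≠ 0 ∧ MemLp (π.coeff η η) 2 μ

end Basic

section DirectSum

variable {J : Type*} {H : J → Type*} [∀ j, NormedAddCommGroup (H j)]
  [∀ j, InnerProductSpace ℂ (H j)] [∀ j, CompleteSpace (H j)]

/-- The operator `(ξ_j)_j ↦ (π_j(x) ξ_j)_j` on the Hilbert space direct sum. -/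
def directSumMap (π : ∀ j, UnitaryRep G (H j)) (x : G) : lp H 2 →ₗᵢ[ℂ] lp H 2 where
  toFun ξ := ⟨fun j => (π j).toHom x (ξ j), by
    refine memℓp_gen ?_
    simpa using (lp.memℓp ξ).summable (by norm_num)⟩
  map_add' ξ η := by ext j; exact map_add ((π j).toHom x) (ξ j) (η j)
  map_smul' c ξ := by ext j; simp
  norm_map' ξ := by
    rw [lp.norm_eq_tsum_rpow (by norm_num), lp.norm_eq_tsum_rpow (by norm_num)]
    simp

/-- The direct sum `⊕_j π_j` on the Hilbert space direct sum `⊕_j H_j`. -/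
def directSum (π : ∀ j, UnitaryRep G (H j)) : UnitaryRep G (lp H 2) :=
  ofIsometries (directSumMap π)
    (fun ξ => by ext j; simp [directSumMap])
    (fun x y ξ => by ext j; simp [directSumMap])
    (fun ξ η => by
      simp only [lp.inner_eq_tsum]
      have hs : Summable fun j => ‖η j‖ * ‖ξ j‖ := by
        have h2 : (2 : ENNReal).toReal = 2 := by norm_num
        have h1 := (lp.memℓp η).summable (by norm_num)
        have h3 := (lp.memℓp ξ).summable (by norm_num)
        rw [h2] at h1 h3
        refine Summable.of_nonneg_of_le (fun j => by positivity) (fun j => ?_) (h1.add h3)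
        simp only [Real.rpow_two]
        nlinarith [sq_nonneg (‖η j‖ - ‖ξ j‖), sq_nonneg (‖η j‖ + ‖ξ j‖)]
      refine continuous_tsum (fun j => (π j).continuous_inner (ξ j) (η j)) hs (fun j x => ?_)
      refine (norm_inner_le_norm _ _).trans (le_of_eq ?_)
      simp [directSumMap])

theorem directSum_apply (π : ∀ j, UnitaryRep G (H j)) (x : G) (ξ : lp H 2) (j : J) :
    (directSum π).toHom x ξ j = (π j).toHom x (ξ j) := rfl

end DirectSum

/-- The multiple `m · π`, where `m` is the cardinality of `J`: the direct sum of the constant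
family `(π)_{j ∈ J}`. In particular `multiple ℕ π` is `ℵ₀ · π`. -/
def multiple (J : Type*) {H : Type*} [NormedAddCommGroup H] [InnerProductSpace ℂ H]
    [CompleteSpace H] (π : UnitaryRep G H) : UnitaryRep G (lp (fun _ : J => H) 2) :=
  directSum fun _ : J => π

section Regular

variable [IsTopologicalGroup G] [MeasurableSpace G] [BorelSpace G]
  (μ : Measure G) [μ.IsMulLeftInvariant] [IsLocallyFiniteMeasure μ] [μ.InnerRegularCompactLTTop]

/-- The left regular representation of `G` on `L²(G, μ)`, for a left Haar measure `μ`: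
`λ(x) f (y) = f (x⁻¹ y)`. -/
def leftRegular : UnitaryRep G (Lp ℂ 2 μ) :=
  ofIsometries
    (fun x => Lp.compMeasurePreservingₗᵢ ℂ (fun y : G => x⁻¹ * y) (measurePreserving_mul_left μ x⁻¹))
    (fun f => by
      refine Lp.ext ((Lp.coeFn_compMeasurePreserving f (measurePreserving_mul_left μ 1⁻¹)).trans ?_)
      exact .of_forall fun y => by simp)
    (fun x y f => by
      have h := Lp.compMeasurePreserving_comp_apply f (measurePreserving_mul_left μ y⁻¹)
        (measurePreserving_mul_left μ x⁻¹)
      refine Eq.trans ?_ h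
      simp only [Lp.compMeasurePreservingₗᵢ_apply_coe, Subtype.ext_iff,
        Lp.compMeasurePreserving_val]
      congr 1
      funext z
      simp [mul_assoc])
    (fun ξ η => by
      let g : C(G, C(G, G)) := ContinuousMap.curry ⟨fun a : G × G => a.1⁻¹ * a.2, by fun_prop⟩
      have h : Continuous fun x : G => Lp.compMeasurePreserving (E := ℂ) (p := 2) (g x)
          (measurePreserving_mul_left μ x⁻¹) η :=
        continuous_const.compMeasurePreservingLp g.continuous _ (by norm_num)
      exact h.inner continuous_const)

theorem leftRegular_apply_ae (x : G) (f : Lp ℂ 2 μ) :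
    (leftRegular μ).toHom x f =ᵐ[μ] fun y => f (x⁻¹ * y) :=
  Lp.coeFn_compMeasurePreserving f (measurePreserving_mul_left μ x⁻¹)

end Regular

end UnitaryRep

/-! ### The affine group of the line -/

/-- The group `G₁` of invertible affine transformations of the line. The element
`[x, a] = ⟨x, a⟩` is the transformation `z ↦ x + a z`, where `x ∈ ℝ` and `a ∈ ℝ \ {0}`. -/
@[ext]
structure AffineLineGroup where
  /-- the translation part -/
  x : ℝ
  /-- the linear part -/
  a : ℝˣ

namespace AffineLineGroup

/-- The affine transformation `z ↦ x + a z` given by an element of the group. -/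
def toMap (g : AffineLineGroup) (z : ℝ) : ℝ := g.x + g.a * z

/-- `[x, a] [y, b] = [x + a y, a b]`. -/
instance : Mul AffineLineGroup := ⟨fun g h => ⟨g.x + g.a * h.x, g.a * h.a⟩⟩

instance : One AffineLineGroup := ⟨⟨0, 1⟩⟩

instance : Inv AffineLineGroup := ⟨fun g => ⟨-((g.a⁻¹ : ℝˣ) * g.x), g.a⁻¹⟩⟩

@[simp] theorem mul_x (g h : AffineLineGroup) : (g * h).x = g.x + g.a * h.x := rfl
@[simp] theorem mul_a (g h : AffineLineGroup) : (g * h).a = g.a * h.a := rfl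
@[simp] theorem one_x : (1 : AffineLineGroup).x = 0 := rfl
@[simp] theorem one_a : (1 : AffineLineGroup).a = 1 := rfl
@[simp] theorem inv_x (g : AffineLineGroup) : g⁻¹.x = -((g.a⁻¹ : ℝˣ) * g.x) := rfl
@[simp] theorem inv_a (g : AffineLineGroup) : g⁻¹.a = g.a⁻¹ := rfl

instance : Group AffineLineGroup :=
  Group.ofLeftAxioms
    (fun g h k => by ext <;> simp <;> ring)
    (fun g => by ext <;> simp)
    (fun g => by ext <;> simp)

/-- The group law is the composition of affine transformations. -/
theorem toMap_mul (g h : AffineLineGroup) : (g * h).toMap = g.toMap ∘ h.toMap := by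
  funext z
  simp only [toMap, mul_x, mul_a, Units.val_mul, Function.comp]
  ring

/-- The bijection `[x, a] ↦ (x, a)`. -/
def equivProd : AffineLineGroup ≃ ℝ × ℝˣ where
  toFun g := (g.x, g.a)
  invFun p := ⟨p.1, p.2⟩
  left_inv _ := rfl
  right_inv _ := rfl

/-- The topology carried over from `ℝ × (ℝ \ {0})`. -/
instance : TopologicalSpace AffineLineGroup := TopologicalSpace.induced equivProd inferInstance

/-- The bijection `[x, a] ↦ (x, a)` as a homeomorphism. -/
def homeoProd : AffineLineGroup ≃ₜ ℝ × ℝˣ := equivProd.toHomeomorphOfIsInducing ⟨rfl⟩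

@[fun_prop]
theorem continuous_x : Continuous AffineLineGroup.x := continuous_fst.comp homeoProd.continuous

@[fun_prop]
theorem continuous_a : Continuous AffineLineGroup.a := continuous_snd.comp homeoProd.continuous

theorem continuous_mk {X : Type*} [TopologicalSpace X] {u : X → ℝ} {v : X → ℝˣ}
    (hu : Continuous u) (hv : Continuous v) : Continuous fun t => AffineLineGroup.mk (u t) (v t) :=
  homeoProd.symm.continuous.comp (hu.prodMk hv)

instance : IsTopologicalGroup AffineLineGroup where
  continuous_mul := continuous_mk (by fun_prop) (by fun_prop)
  continuous_inv := continuous_mk (by fun_prop) (by fun_prop)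

instance : T2Space AffineLineGroup := homeoProd.symm.t2Space

instance : LocallyCompactSpace AffineLineGroup :=
  homeoProd.isClosedEmbedding.locallyCompactSpace

instance : SecondCountableTopology AffineLineGroup :=
  haveI : SecondCountableTopology ℝˣ := Units.isEmbedding_val₀.isInducing.secondCountableTopology
  homeoProd.isInducing.secondCountableTopology

/-- The Borel σ-algebra. -/
instance : MeasurableSpace AffineLineGroup := borel AffineLineGroup

instance : BorelSpace AffineLineGroup := ⟨rfl⟩

/-! ### The natural representation on `L²(ℝ)` -/

/-- The inverse affine transformation `y ↦ a⁻¹ (y - x)`. -/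
def invMap (g : AffineLineGroup) (y : ℝ) : ℝ := (g.a : ℝ)⁻¹ * (y - g.x)

theorem toMap_invMap (g : AffineLineGroup) (y : ℝ) : g.toMap (g.invMap y) = y := by
  simp [toMap, invMap]

theorem measurePreserving_invMap (g : AffineLineGroup) :
    MeasurePreserving g.invMap volume (ENNReal.ofReal |(g.a : ℝ)| • volume) := by
  have h1 : MeasurePreserving (fun y : ℝ => y - g.x) volume volume :=
    measurePreserving_sub_right volume g.x
  have h2 : MeasurePreserving (fun y : ℝ => (g.a : ℝ)⁻¹ * y) volume
      (ENNReal.ofReal |(g.a : ℝ)| • volume) :=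
    ⟨by fun_prop, by
      rw [Real.map_volume_mul_left (inv_ne_zero g.a.ne_zero), inv_inv]⟩
  exact h2.comp h1

theorem quasiMeasurePreserving_invMap (g : AffineLineGroup) :
    Measure.QuasiMeasurePreserving g.invMap volume volume :=
  g.measurePreserving_invMap.quasiMeasurePreserving.mono_right
    (Measure.smul_absolutelyContinuous)

theorem memLp_comp_invMap (g : AffineLineGroup) (f : Lp ℂ 2 (volume : Measure ℝ)) :
    MemLp (fun y => f (g.invMap y)) 2 volume :=
  ((Lp.memLp f).smul_measure ENNReal.ofReal_ne_top).comp_measurePreserving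
    g.measurePreserving_invMap

/-- The factor `|a|^{-1/2}`. -/
def factor (g : AffineLineGroup) : ℝ := |(g.a : ℝ)| ^ (-(1 / 2) : ℝ)

theorem memLp_natural (g : AffineLineGroup) (f : Lp ℂ 2 (volume : Measure ℝ)) :
    MemLp (fun y => (g.factor : ℂ) * f (g.invMap y)) 2 volume :=
  (g.memLp_comp_invMap f).const_mul _

/-- The operator `f ↦ |a|^{-1/2} f (a⁻¹ (· - x))` on `L²(ℝ)`. -/
def naturalMap (g : AffineLineGroup) :
    Lp ℂ 2 (volume : Measure ℝ) →ₗᵢ[ℂ] Lp ℂ 2 (volume : Measure ℝ) where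
  toFun f := (g.memLp_natural f).toLp _
  map_add' f h := by
    rw [← MemLp.toLp_add]
    refine MemLp.toLp_congr _ _ ?_
    filter_upwards [g.quasiMeasurePreserving_invMap.ae (Lp.coeFn_add f h)] with y hy
    rw [hy]
    simp [mul_add]
  map_smul' c f := by
    rw [RingHom.id_apply, ← MemLp.toLp_const_smul]
    refine MemLp.toLp_congr _ _ ?_
    filter_upwards [g.quasiMeasurePreserving_invMap.ae (Lp.coeFn_smul c f)] with y hy
    rw [hy]
    simp only [Pi.smul_apply, smul_eq_mul]
    ring
  norm_map' f := by
    have ha : 0 < |(g.a : ℝ)| := abs_pos.2 g.a.ne_zero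
    have h := eLpNorm_comp_measurePreserving (p := 2)
      ((Lp.memLp f).smul_measure (c := ENNReal.ofReal |(g.a : ℝ)|)
        ENNReal.ofReal_ne_top).aestronglyMeasurable g.measurePreserving_invMap
    have h2 : eLpNorm (fun y => (g.factor : ℂ) * f (g.invMap y)) 2 volume = eLpNorm f 2 volume := by
      have h3 := eLpNorm_const_smul (g.factor : ℂ) (f ∘ g.invMap) 2 volume
      refine h3.trans ?_
      rw [h, eLpNorm_smul_measure_of_ne_top (by norm_num), smul_eq_mul, ← mul_assoc]
      have h4 : ‖(g.factor : ℂ)‖ₑ * ENNReal.ofReal |(g.a : ℝ)| ^ (1 / (2 : ENNReal)).toReal = 1 := by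
        have h5 : (1 / (2 : ENNReal)).toReal = 1 / 2 := by simp
        have h6 : ‖(g.factor : ℂ)‖ₑ = ENNReal.ofReal g.factor := by
          rw [← ofReal_norm, Complex.norm_real, Real.norm_eq_abs,
            abs_of_nonneg (by unfold factor; positivity)]
        rw [h5, h6, ENNReal.ofReal_rpow_of_pos ha, ← ENNReal.ofReal_mul (by unfold factor; positivity),
          factor, ← Real.rpow_add ha]
        simp
      rw [h4, one_mul]
    exact (Lp.norm_toLp _ (g.memLp_natural f)).trans (by rw [h2, Lp.norm_def])

theorem naturalMap_apply_ae (g : AffineLineGroup) (f : Lp ℂ 2 (volume : Measure ℝ)) :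
    g.naturalMap f =ᵐ[volume] fun y => (g.factor : ℂ) * f (g.invMap y) :=
  (g.memLp_natural f).coeFn_toLp

theorem continuous_factor : Continuous factor := by
  unfold factor
  refine Continuous.rpow_const (by fun_prop) fun g => Or.inl ?_
  exact (abs_pos.2 g.a.ne_zero).ne'

theorem continuous_invMap (y : ℝ) : Continuous fun g : AffineLineGroup => g.invMap y := by
  have h : (fun g : AffineLineGroup => g.invMap y) =
      fun g => ((g.a⁻¹ : ℝˣ) : ℝ) * (y - g.x) := by
    funext g; simp [invMap]
  rw [h]
  fun_prop

theorem continuous_inner_natural_of_compactSupport {u v : ℝ → ℂ} (hu : Continuous u)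
    (hus : HasCompactSupport u) (hv : Continuous v) (hvs : HasCompactSupport v)
    (hu2 : MemLp u 2 volume) (hv2 : MemLp v 2 volume) :
    Continuous fun g : AffineLineGroup => inner ℂ (g.naturalMap (hv2.toLp v)) (hu2.toLp u) := by
  obtain ⟨C, hC⟩ := hv.bounded_above_of_compact_support hvs
  have h1 : ∀ g : AffineLineGroup, inner ℂ (g.naturalMap (hv2.toLp v)) (hu2.toLp u) =
      (g.factor : ℂ) * ∫ y, u y * (starRingEnd ℂ) (v (g.invMap y)) := by
    intro g
    rw [L2.inner_def, ← integral_const_mul]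
    refine integral_congr_ae ?_
    filter_upwards [g.naturalMap_apply_ae (hv2.toLp v), hu2.coeFn_toLp,
      g.quasiMeasurePreserving_invMap.ae hv2.coeFn_toLp] with y h1 h2 h3
    rw [h1, h2, h3]
    simp only [RCLike.inner_apply, map_mul, Complex.conj_ofReal]
    ring
  simp only [h1]
  refine (Complex.continuous_ofReal.comp continuous_factor).mul ?_
  refine continuous_of_dominated (bound := fun y => ‖u y‖ * C) (fun g => ?_) (fun g => ?_) ?_ ?_
  · refine Continuous.aestronglyMeasurable ?_
    have : Continuous g.invMap := by unfold invMap; fun_prop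
    fun_prop
  · refine .of_forall fun y => ?_
    rw [norm_mul, RCLike.norm_conj]
    exact mul_le_mul_of_nonneg_left (hC _) (norm_nonneg _)
  · exact ((hu.integrable_of_hasCompactSupport hus).norm).mul_const C
  · refine .of_forall fun y => ?_
    exact continuous_const.mul (Complex.continuous_conj.comp (hv.comp (continuous_invMap y)))

theorem exists_compactSupport_approx (f : Lp ℂ 2 (volume : Measure ℝ)) {ε : ℝ} (hε : 0 < ε) :
    ∃ (u : ℝ → ℂ) (hu2 : MemLp u 2 volume), Continuous u ∧ HasCompactSupport u ∧
      ‖f - hu2.toLp u‖ ≤ ε := by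
  obtain ⟨u, hus, hle, hu, hu2⟩ := (Lp.memLp f).exists_hasCompactSupport_eLpNorm_sub_le
    (by norm_num) (ENNReal.ofReal_pos.2 hε).ne'
  refine ⟨u, hu2, hu, hus, ?_⟩
  have h : f - hu2.toLp u = ((Lp.memLp f).sub hu2).toLp _ := by
    rw [MemLp.toLp_sub (Lp.memLp f) hu2, Lp.toLp_coeFn]
  rw [h, Lp.norm_toLp]
  exact ENNReal.toReal_le_of_le_ofReal hε.le hle

theorem continuous_inner_natural (ξ η : Lp ℂ 2 (volume : Measure ℝ)) :
    Continuous fun g : AffineLineGroup => inner ℂ (g.naturalMap η) ξ := by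
  refine continuous_of_uniform_approx_of_continuous fun U hU => ?_
  obtain ⟨ε, hε, hεU⟩ := Metric.mem_uniformity_dist.1 hU
  obtain ⟨δ, hδ, hδ1, hδε⟩ : ∃ δ : ℝ, 0 < δ ∧ δ ≤ 1 ∧ δ * (‖ξ‖ + ‖η‖ + 1) < ε := by
    refine ⟨min 1 (ε / (2 * (‖ξ‖ + ‖η‖ + 1))), by positivity, min_le_left _ _, ?_⟩
    calc min 1 (ε / (2 * (‖ξ‖ + ‖η‖ + 1))) * (‖ξ‖ + ‖η‖ + 1)
        ≤ ε / (2 * (‖ξ‖ + ‖η‖ + 1)) * (‖ξ‖ + ‖η‖ + 1) :=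
          mul_le_mul_of_nonneg_right (min_le_right _ _) (by positivity)
      _ = ε / 2 := by field_simp
      _ < ε := half_lt_self hε
  obtain ⟨u, hu2, hu, hus, hξ⟩ := exists_compactSupport_approx ξ hδ
  obtain ⟨v, hv2, hv, hvs, hη⟩ := exists_compactSupport_approx η hδ
  refine ⟨_, continuous_inner_natural_of_compactSupport hu hus hv hvs hu2 hv2, fun g => hεU ?_⟩
  rw [dist_eq_norm]
  have h1 : inner ℂ (g.naturalMap η) ξ - inner ℂ (g.naturalMap (hv2.toLp v)) (hu2.toLp u) =
      inner ℂ (g.naturalMap (η - hv2.toLp v)) ξ +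
        inner ℂ (g.naturalMap (hv2.toLp v)) (ξ - hu2.toLp u) := by
    rw [map_sub, inner_sub_left, inner_sub_right]
    ring
  have h2 : ‖hv2.toLp v‖ ≤ ‖η‖ + δ := by
    have h := norm_sub_le η (η - hv2.toLp v)
    rw [sub_sub_cancel] at h
    linarith
  have h3 := norm_inner_le_norm (𝕜 := ℂ) (g.naturalMap (η - hv2.toLp v)) ξ
  have h4 := norm_inner_le_norm (𝕜 := ℂ) (g.naturalMap (hv2.toLp v)) (ξ - hu2.toLp u)
  rw [LinearIsometry.norm_map] at h3 h4
  have h5 := mul_le_mul_of_nonneg_right hη (norm_nonneg ξ)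
  have h6 := mul_le_mul h2 hξ (norm_nonneg _) (by positivity)
  have h7 := norm_add_le (inner ℂ (g.naturalMap (η - hv2.toLp v)) ξ)
    (inner ℂ (g.naturalMap (hv2.toLp v)) (ξ - hu2.toLp u))
  rw [h1]
  nlinarith

/-- The natural representation `ρ` of `G₁` on `L²(ℝ)`:
`ρ[x, a] f (y) = |a|^{-1/2} f (a⁻¹ (y - x))`. -/
def natural : UnitaryRep AffineLineGroup (Lp ℂ 2 (volume : Measure ℝ)) :=
  UnitaryRep.ofIsometries naturalMap
    (fun f => by
      refine Lp.ext ((naturalMap_apply_ae 1 f).trans (.of_forall fun y => ?_))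
      simp [factor, invMap])
    (fun g h f => by
      refine Lp.ext ((naturalMap_apply_ae (g * h) f).trans ?_)
      filter_upwards [naturalMap_apply_ae g (h.naturalMap f),
        g.quasiMeasurePreserving_invMap.ae (naturalMap_apply_ae h f)] with y h1 h2
      rw [h1, h2, ← mul_assoc]
      have e1 : (g * h).factor = g.factor * h.factor := by
        simp only [factor, mul_a, Units.val_mul, abs_mul]
        exact Real.mul_rpow (abs_nonneg _) (abs_nonneg _)
      have e2 : (g * h).invMap y = h.invMap (g.invMap y) := by
        have hg := g.a.ne_zero
        have hh := h.a.ne_zero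
        simp only [invMap, mul_a, mul_x, Units.val_mul]
        field_simp
        ring
      rw [e1, e2, Complex.ofReal_mul])
    continuous_inner_natural

theorem natural_apply_ae (g : AffineLineGroup) (f : Lp ℂ 2 (volume : Measure ℝ)) :
    natural.toHom g f =ᵐ[volume]
      fun y => ((|(g.a : ℝ)| ^ (-(1 / 2) : ℝ) : ℝ) : ℂ) * f ((g.a : ℝ)⁻¹ * (y - g.x)) :=
  g.naturalMap_apply_ae f

end AffineLineGroup

end

/-! Regular representation. In coordinates (y, b) the left Haar measure is a multiple of b⁻² dy db,
so multiplying functions by a constant times |b|⁻¹ carries L²(G₁, μ) onto L²(ℝ²), and the left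
translation by g = [x, a] becomes ρ(g) ⊗ ρ[0, a] (`exists_unitary_leftRegular`). A Fourier transform
in y (`exists_partialFourier`) turns ρ(g) into ρ̂(g) : f ↦ |a|^{1/2} e^{-2πixξ} f(aξ). The arguments
now move by (ξ, b) ↦ (aξ, b/a), which leaves c = ξb fixed. In the coordinates (ξ, c) the
representation is therefore ρ̂(g) ⊗ 1 (`exists_unitary_planeDual`). Expanding in c along an
orthonormal basis of L²(ℝ), and undoing the Fourier transform in each summand, gives ℵ₀ · ρ.

Irreducibility. If h is orthogonal to every ρ(g) f, then by Plancherel, for each a ≠ 0, the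
integrable function ξ ↦ ĥ(ξ) conj f̂(aξ) has vanishing Fourier transform, hence is zero almost
everywhere. Letting a vary, Fubini forces f = 0 or h = 0 (`eq_zero_or_eq_zero_of_inner_naturalMap`).

Square-integrability. The coefficient of η(y) = y e^{-y²} is an explicit Gaussian integral. That η
has mean zero makes the coefficient small enough as a → 0; for e^{-y²} the integral against b⁻² dx
db would diverge logarithmically there.

Apart from the Fourier transform, the operators have the form f ↦ w · (f ∘ φ), so their identities
reduce to pointwise ones. -/

open scoped ENNReal NNReal

noncomputable section

/-! ### Weighted composition operators between L² spaces -/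

section WeightedComposition

variable {X Y Z : Type*} [MeasurableSpace X] [MeasurableSpace Y] [MeasurableSpace Z]
  {μ : Measure X} {ν : Measure Y} {κ : Measure Z}

/-- The map `φ` pushes the measure `|w|² μ` forward to `ν`. -/
structure IsWeightedPreserving (φ : X → Y) (w : X → ℂ) (μ : Measure X) (ν : Measure Y) : Prop where
  measurable_map : Measurable φ
  measurable_weight : Measurable w
  map_eq : (μ.withDensity fun x => ‖w x‖ₑ ^ 2).map φ = ν

namespace IsWeightedPreserving

variable {φ : X → Y} {w : X → ℂ} {ψ : Y → Z} {v : Y → ℂ}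

theorem ae_of_ae (h : IsWeightedPreserving φ w μ ν) {p : Y → Prop} (hp : ∀ᵐ y ∂ν, p y) :
    ∀ᵐ x ∂μ, w x = 0 ∨ p (φ x) := by
  rw [← h.map_eq] at hp
  have h1 := ae_of_ae_map h.measurable_map.aemeasurable hp
  rw [ae_withDensity_iff (h.measurable_weight.enorm.pow_const 2)] at h1
  filter_upwards [h1] with x hx
  by_cases hw : w x = 0
  · exact Or.inl hw
  · exact Or.inr (hx (by simpa using hw))

theorem mul_comp_ae_eq (h : IsWeightedPreserving φ w μ ν) {f g : Y → ℂ} (hfg : f =ᵐ[ν] g) :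
    (fun x => w x * f (φ x)) =ᵐ[μ] fun x => w x * g (φ x) := by
  filter_upwards [h.ae_of_ae hfg] with x hx
  rcases hx with hx | hx
  · simp [hx]
  · simp only [hx]

theorem eLpNorm_mul_comp (h : IsWeightedPreserving φ w μ ν) {f : Y → ℂ} (hf : Measurable f) :
    eLpNorm (fun x => w x * f (φ x)) 2 μ = eLpNorm f 2 ν := by
  have h2 : (2 : ℝ≥0∞).toReal = 2 := by norm_num
  rw [eLpNorm_eq_lintegral_rpow_enorm_toReal (by norm_num) (by norm_num),
    eLpNorm_eq_lintegral_rpow_enorm_toReal (by norm_num) (by norm_num), h2, ← h.map_eq,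
    lintegral_map (by fun_prop) h.measurable_map,
    lintegral_withDensity_eq_lintegral_mul _ (h.measurable_weight.enorm.pow_const 2)
      (by have := h.measurable_map; fun_prop)]
  congr 1
  refine lintegral_congr fun x => ?_
  simp [mul_pow]

theorem memLp_mul_comp (h : IsWeightedPreserving φ w μ ν) (f : Lp ℂ 2 ν) :
    MemLp (fun x => w x * f (φ x)) 2 μ := by
  have hf : Measurable f := (Lp.stronglyMeasurable f).measurable
  refine ⟨(h.measurable_weight.mul (hf.comp h.measurable_map)).aestronglyMeasurable, ?_⟩
  rw [h.eLpNorm_mul_comp hf]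
  exact Lp.eLpNorm_lt_top f

/-- The isometry `f ↦ w · (f ∘ φ)` of `L²` spaces. -/
def weightedComp (h : IsWeightedPreserving φ w μ ν) : Lp ℂ 2 ν →ₗᵢ[ℂ] Lp ℂ 2 μ where
  toFun f := (h.memLp_mul_comp f).toLp _
  map_add' f g := by
    rw [← MemLp.toLp_add]
    refine MemLp.toLp_congr _ _ ((h.mul_comp_ae_eq (Lp.coeFn_add f g)).trans ?_)
    exact .of_forall fun x => mul_add _ _ _
  map_smul' c f := by
    rw [RingHom.id_apply, ← MemLp.toLp_const_smul]
    refine MemLp.toLp_congr _ _ ((h.mul_comp_ae_eq (Lp.coeFn_smul c f)).trans ?_)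
    exact .of_forall fun x => mul_left_comm _ _ _
  norm_map' f := by
    refine (Lp.norm_toLp _ (h.memLp_mul_comp f)).trans ?_
    rw [h.eLpNorm_mul_comp (Lp.stronglyMeasurable f).measurable, Lp.norm_def]

theorem weightedComp_ae (h : IsWeightedPreserving φ w μ ν) (f : Lp ℂ 2 ν) :
    h.weightedComp f =ᵐ[μ] fun x => w x * f (φ x) :=
  (h.memLp_mul_comp f).coeFn_toLp

theorem weightedComp_ae_of_ae (h : IsWeightedPreserving φ w μ ν) {f : Lp ℂ 2 ν} {g : Y → ℂ}
    (hfg : f =ᵐ[ν] g) : h.weightedComp f =ᵐ[μ] fun x => w x * g (φ x) :=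
  (h.weightedComp_ae f).trans (h.mul_comp_ae_eq hfg)

theorem weightedComp_comp_ae (h : IsWeightedPreserving φ w μ ν) (h' : IsWeightedPreserving ψ v ν κ)
    (f : Lp ℂ 2 κ) : h.weightedComp (h'.weightedComp f) =ᵐ[μ]
      fun x => w x * (v (φ x) * f (ψ (φ x))) :=
  h.weightedComp_ae_of_ae (h'.weightedComp_ae f)

variable {φ' : Y → X} {w' : Y → ℂ}

/-- Substituting ν = φ_*(|w|² μ), the integral of |w'|² over φ'⁻¹(s) becomes the μ-integral over s
of |w · (w' ∘ φ)|² = 1. A one-sided inverse, μ-almost everywhere, is enough. -/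
theorem inverse (h : IsWeightedPreserving φ w μ ν) (hφ' : Measurable φ') (hw' : Measurable w')
    (hinv : ∀ᵐ x ∂μ, w x * w' (φ x) = 1 ∧ φ' (φ x) = x) : IsWeightedPreserving φ' w' ν μ where
  measurable_map := hφ'
  measurable_weight := hw'
  map_eq := by
    have hw2 : Measurable fun y => ‖w' y‖ₑ ^ 2 := hw'.enorm.pow_const 2
    ext s hs
    rw [Measure.map_apply hφ' hs, withDensity_apply _ (hφ' hs), ← h.map_eq,
      setLIntegral_map (hφ' hs) hw2 h.measurable_map,
      setLIntegral_withDensity_eq_setLIntegral_mul (g := fun x => ‖w' (φ x)‖ₑ ^ 2) _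
        (h.measurable_weight.enorm.pow_const 2)
        (hw2.comp h.measurable_map) (h.measurable_map (hφ' hs)),
      ← lintegral_indicator (h.measurable_map (hφ' hs)), ← lintegral_indicator_one hs]
    refine lintegral_congr_ae ?_
    filter_upwards [hinv] with x hx
    have h1 : ‖w x‖ₑ ^ 2 * ‖w' (φ x)‖ₑ ^ 2 = 1 := by
      rw [← mul_pow, ← enorm_mul, hx.1]; simp
    by_cases hxs : x ∈ s
    · rw [Set.indicator_of_mem (by simpa [hx.2] using hxs), Set.indicator_of_mem hxs]
      exact h1
    · rw [Set.indicator_of_notMem (by simpa [hx.2] using hxs), Set.indicator_of_notMem hxs]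

/-- A weighted composition with an inverse is unitary. -/
def weightedEquiv (h : IsWeightedPreserving φ w μ ν) (hφ' : Measurable φ') (hw' : Measurable w')
    (hinv : ∀ᵐ x ∂μ, w x * w' (φ x) = 1 ∧ φ' (φ x) = x) : Lp ℂ 2 ν ≃ₗᵢ[ℂ] Lp ℂ 2 μ :=
  LinearIsometryEquiv.ofSurjective h.weightedComp fun f =>
    ⟨(h.inverse hφ' hw' hinv).weightedComp f, by
      refine Lp.ext ((h.weightedComp_comp_ae _ f).trans ?_)
      filter_upwards [hinv] with x hx
      rw [← mul_assoc, hx.1, hx.2, one_mul]⟩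

end IsWeightedPreserving

end WeightedComposition

/-! ### Elementary tensors in L² of a product -/

section Tensor

variable {X Y ι : Type*} [MeasurableSpace X] [MeasurableSpace Y]
  {μ : Measure X} {ν : Measure Y}

theorem memLp_two_tensor (f : Lp ℂ 2 μ) (k : Lp ℂ 2 ν) :
    MemLp (fun z : X × Y => f z.1 * k z.2) 2 (μ.prod ν) := by
  have h1 : AEStronglyMeasurable (fun z : X × Y => f z.1 * k z.2) (μ.prod ν) :=
    (Lp.aestronglyMeasurable f).comp_fst.mul (Lp.aestronglyMeasurable k).comp_snd
  refine (memLp_two_iff_integrable_sq_norm h1).2 ?_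
  simp only [norm_mul, mul_pow]
  exact ((memLp_two_iff_integrable_sq_norm (Lp.aestronglyMeasurable f)).1 (Lp.memLp f)).mul_prod
    ((memLp_two_iff_integrable_sq_norm (Lp.aestronglyMeasurable k)).1 (Lp.memLp k))

/-- The elementary tensor `(x, y) ↦ f x * k y` as an element of `L²` of the product. -/
def tensorLp (f : Lp ℂ 2 μ) (k : Lp ℂ 2 ν) : Lp ℂ 2 (μ.prod ν) := (memLp_two_tensor f k).toLp _

theorem tensorLp_ae (f : Lp ℂ 2 μ) (k : Lp ℂ 2 ν) :
    tensorLp f k =ᵐ[μ.prod ν] fun z => f z.1 * k z.2 := (memLp_two_tensor f k).coeFn_toLp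

theorem tensorLp_add_left (f f' : Lp ℂ 2 μ) (k : Lp ℂ 2 ν) :
    tensorLp (f + f') k = tensorLp f k + tensorLp f' k := by
  refine Lp.ext ?_
  filter_upwards [tensorLp_ae (f + f') k, tensorLp_ae f k, tensorLp_ae f' k,
    Lp.coeFn_add (tensorLp f k) (tensorLp f' k),
    Measure.quasiMeasurePreserving_fst.ae (Lp.coeFn_add f f')] with z h1 h2 h3 h4 h5
  rw [h1, h4, Pi.add_apply, h2, h3, h5, Pi.add_apply, add_mul]

theorem tensorLp_add_right (f : Lp ℂ 2 μ) (k k' : Lp ℂ 2 ν) :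
    tensorLp f (k + k') = tensorLp f k + tensorLp f k' := by
  refine Lp.ext ?_
  filter_upwards [tensorLp_ae f (k + k'), tensorLp_ae f k, tensorLp_ae f k',
    Lp.coeFn_add (tensorLp f k) (tensorLp f k'),
    Measure.quasiMeasurePreserving_snd.ae (Lp.coeFn_add k k')] with z h1 h2 h3 h4 h5
  rw [h1, h4, Pi.add_apply, h2, h3, h5, Pi.add_apply, mul_add]

theorem tensorLp_smul_left (c : ℂ) (f : Lp ℂ 2 μ) (k : Lp ℂ 2 ν) :
    tensorLp (c • f) k = c • tensorLp f k := by
  refine Lp.ext ?_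
  filter_upwards [tensorLp_ae (c • f) k, tensorLp_ae f k, Lp.coeFn_smul c (tensorLp f k),
    Measure.quasiMeasurePreserving_fst.ae (Lp.coeFn_smul c f)] with z h1 h2 h3 h4
  rw [h1, h3, Pi.smul_apply, h2, h4, Pi.smul_apply, smul_mul_assoc]

theorem tensorLp_smul_right (c : ℂ) (f : Lp ℂ 2 μ) (k : Lp ℂ 2 ν) :
    tensorLp f (c • k) = c • tensorLp f k := by
  refine Lp.ext ?_
  filter_upwards [tensorLp_ae f (c • k), tensorLp_ae f k, Lp.coeFn_smul c (tensorLp f k),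
    Measure.quasiMeasurePreserving_snd.ae (Lp.coeFn_smul c k)] with z h1 h2 h3 h4
  rw [h1, h3, Pi.smul_apply, h2, h4, Pi.smul_apply, mul_smul_comm]

variable [SigmaFinite μ] [SigmaFinite ν]

theorem inner_tensorLp (f f' : Lp ℂ 2 μ) (k k' : Lp ℂ 2 ν) :
    inner ℂ (tensorLp f k) (tensorLp f' k') = inner ℂ f f' * inner ℂ k k' := by
  simp only [L2.inner_def]
  rw [← integral_prod_mul]
  refine integral_congr_ae ?_
  filter_upwards [tensorLp_ae f k, tensorLp_ae f' k'] with z h1 h2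
  rw [h1, h2]
  simp only [RCLike.inner_apply, map_mul]
  ring

theorem norm_tensorLp (f : Lp ℂ 2 μ) (k : Lp ℂ 2 ν) : ‖tensorLp f k‖ = ‖f‖ * ‖k‖ := by
  have h := inner_tensorLp f f k k
  simp only [inner_self_eq_norm_sq_to_K, ← Complex.ofReal_pow, ← Complex.ofReal_mul,
    Complex.coe_algebraMap, Complex.ofReal_inj, ← mul_pow] at h
  exact (pow_left_inj₀ (norm_nonneg _) (by positivity) two_ne_zero).1 (by exact_mod_cast h)

/-- `k ↦ f ⊗ k` as a continuous linear map. -/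
def tensorCLM (f : Lp ℂ 2 μ) : Lp ℂ 2 ν →L[ℂ] Lp ℂ 2 (μ.prod ν) :=
  LinearMap.mkContinuous
    { toFun := tensorLp f
      map_add' := tensorLp_add_right f
      map_smul' := fun c k => tensorLp_smul_right c f k } ‖f‖ fun k => (norm_tensorLp f k).le

/-- `f ↦ f ⊗ k` as an isometry, for a unit vector `k`. -/
def tensorₗᵢ (k : Lp ℂ 2 ν) (hk : ‖k‖ = 1) : Lp ℂ 2 μ →ₗᵢ[ℂ] Lp ℂ 2 (μ.prod ν) where
  toFun f := tensorLp f k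
  map_add' f f' := tensorLp_add_left f f' k
  map_smul' c f := tensorLp_smul_left c f k
  norm_map' f := (norm_tensorLp f k).trans (by rw [hk, mul_one])

theorem tensorₗᵢ_apply (k : Lp ℂ 2 ν) (hk : ‖k‖ = 1) (f : Lp ℂ 2 μ) :
    tensorₗᵢ k hk f = tensorLp f k := rfl

theorem ae_memLp_two_slice (F : Lp ℂ 2 (μ.prod ν)) :
    ∀ᵐ x ∂μ, MemLp (fun y => F (x, y)) 2 ν := by
  have h1 := (memLp_two_iff_integrable_sq_norm (Lp.aestronglyMeasurable F)).1 (Lp.memLp F)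
  filter_upwards [h1.prod_right_ae] with x hx
  exact (memLp_two_iff_integrable_sq_norm
    ((Lp.stronglyMeasurable F).comp_measurable measurable_prodMk_left).aestronglyMeasurable).2 hx

/-- Pairing `F` with 1_A ⊗ k integrates the slice pairing over A. A function whose integrals over
all sets of finite measure vanish is zero almost everywhere. -/
theorem ae_integral_slice_eq_zero (F : Lp ℂ 2 (μ.prod ν)) (k : Lp ℂ 2 ν)
    (h : ∀ f : Lp ℂ 2 μ, inner ℂ (tensorLp f k) F = 0) :
    ∀ᵐ x ∂μ, ∫ y, F (x, y) * (starRingEnd ℂ) (k y) ∂ν = 0 := by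
  have key : ∀ A : Set X, MeasurableSet A → μ A < ∞ →
      IntegrableOn (fun x => ∫ y, F (x, y) * (starRingEnd ℂ) (k y) ∂ν) A μ ∧
        ∫ x in A, ∫ y, F (x, y) * (starRingEnd ℂ) (k y) ∂ν ∂μ = 0 := by
    intro A hA hμA
    set f : Lp ℂ 2 μ := indicatorConstLp 2 hA hμA.ne 1
    have e1 : (fun z => inner ℂ (tensorLp f k z) (F z)) =ᵐ[μ.prod ν]
        fun z : X × Y => A.indicator (fun _ => F z * (starRingEnd ℂ) (k z.2)) z.1 := by
      filter_upwards [tensorLp_ae f k, Measure.quasiMeasurePreserving_fst.ae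
        (indicatorConstLp_coeFn (p := 2) (hs := hA) (hμs := hμA.ne) (c := (1 : ℂ)))] with z h1 h2
      rw [h1, h2]
      by_cases hz : z.1 ∈ A <;> simp [hz]
    have hint := (L2.integrable_inner (𝕜 := ℂ) (tensorLp f k) F).congr e1
    have e2 : (fun x => ∫ y, A.indicator (fun _ => F (x, y) * (starRingEnd ℂ) (k y)) x ∂ν) =
        A.indicator fun x => ∫ y, F (x, y) * (starRingEnd ℂ) (k y) ∂ν := by
      funext x
      by_cases hx : x ∈ A <;> simp [hx]
    constructor
    · have h3 := hint.integral_prod_left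
      rw [e2] at h3
      exact (integrable_indicator_iff hA).1 h3
    · have h3 := h f
      rw [L2.inner_def, integral_congr_ae e1, integral_prod _ hint, e2, integral_indicator hA] at h3
      exact h3
  exact ae_eq_zero_of_forall_setIntegral_eq_of_sigmaFinite (fun A hA h => (key A hA h).1)
    fun A hA h => (key A hA h).2

/-- Countability of `ι` gives one null set outside which the slice F(x, ·) is orthogonal to every
basis vector, hence zero; Fubini concludes. -/
theorem eq_zero_of_inner_tensorLp [Countable ι] (b : HilbertBasis ι ℂ (Lp ℂ 2 ν))
    (F : Lp ℂ 2 (μ.prod ν)) (h : ∀ j (f : Lp ℂ 2 μ), inner ℂ (tensorLp f (b j)) F = 0) :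
    F = 0 := by
  refine Lp.ext ((Filter.EventuallyEq.trans ?_ (Lp.coeFn_zero _ _ _).symm))
  have h1 : ∀ᵐ x ∂μ, ∀ j, ∫ y, F (x, y) * (starRingEnd ℂ) (b j y) ∂ν = 0 :=
    ae_all_iff.2 fun j => ae_integral_slice_eq_zero F (b j) (h j)
  have hm : MeasurableSet {z | F z = (0 : X × Y → ℂ) z} :=
    measurableSet_eq_fun (Lp.stronglyMeasurable F).measurable measurable_const
  refine (Measure.ae_prod_iff_ae_ae hm).2 ?_
  filter_upwards [h1, ae_memLp_two_slice F] with x hx hx2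
  have h2 : hx2.toLp _ = 0 := by
    apply b.repr.injective
    ext j
    rw [b.repr_apply_apply, map_zero, L2.inner_def, lp.coeFn_zero, Pi.zero_apply, ← hx j]
    refine integral_congr_ae ?_
    filter_upwards [hx2.coeFn_toLp] with y hy
    rw [hy, RCLike.inner_apply]
  exact hx2.coeFn_toLp.symm.trans ((Lp.eq_zero_iff_ae_eq_zero).1 h2)

/-- The isometries `f ↦ U f ⊗ b_j` exhibit `L²(μ × ν)` as a Hilbert sum of copies of `L²(μ)`. -/
theorem isHilbertSum_tensor [Countable ι] (b : HilbertBasis ι ℂ (Lp ℂ 2 ν))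
    (U : Lp ℂ 2 μ ≃ₗᵢ[ℂ] Lp ℂ 2 μ) :
    IsHilbertSum ℂ (fun _ : ι => Lp ℂ 2 μ) fun j =>
      (tensorₗᵢ (b j) (b.orthonormal.1 j) : Lp ℂ 2 μ →ₗᵢ[ℂ] Lp ℂ 2 (μ.prod ν)).comp
        U.toLinearIsometry := by
  refine IsHilbertSum.mk (fun i j hij f f' => ?_) ?_
  · refine (inner_tensorLp (U f) (U f') (b i) (b j)).trans ?_
    rw [b.orthonormal.2 hij, mul_zero]
  · rw [top_le_iff, Submodule.topologicalClosure_eq_top_iff, Submodule.eq_bot_iff]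
    intro F hF
    refine eq_zero_of_inner_tensorLp b F fun j f => ?_
    refine (Submodule.mem_orthogonal _ F).1 hF _ (Submodule.mem_iSup_of_mem j ?_)
    exact ⟨U.symm f, by simp [tensorₗᵢ_apply]⟩

end Tensor

/-! ### Hilbert sums and Hilbert bases indexed by ℕ -/

theorem IsHilbertSum.ext_continuousLinearMap {ι E E' : Type*} {H : ι → Type*}
    [∀ i, NormedAddCommGroup (H i)] [∀ i, InnerProductSpace ℂ (H i)]
    [NormedAddCommGroup E] [InnerProductSpace ℂ E] [CompleteSpace E]
    [NormedAddCommGroup E'] [InnerProductSpace ℂ E']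
    {V : ∀ i, H i →ₗᵢ[ℂ] E} (hV : IsHilbertSum ℂ H V) {S T : E →L[ℂ] E'}
    (h : ∀ i x, S (V i x) = T (V i x)) : S = T := by
  ext F
  obtain ⟨w, rfl⟩ := hV.linearIsometryEquiv.symm.surjective F
  have hw := hV.hasSum_linearIsometryEquiv_symm w
  have h1 := hw.mapL S
  simp only [h] at h1
  exact h1.unique (hw.mapL T)

theorem HilbertBasis.ext_continuousLinearMap {ι E E' : Type*}
    [NormedAddCommGroup E] [InnerProductSpace ℂ E]
    [NormedAddCommGroup E'] [InnerProductSpace ℂ E']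
    (b : HilbertBasis ι ℂ E) {S T : E →L[ℂ] E'} (h : ∀ i, S (b i) = T (b i)) : S = T :=
  ContinuousLinearMap.ext_on (Submodule.dense_iff_topologicalClosure_eq_top.2 b.dense_span)
    (by rintro _ ⟨i, rfl⟩; exact h i)

/-- Distinct orthonormal vectors are at distance √2, so the balls of radius 1/2 around them are
disjoint open sets in a separable space. -/
theorem Orthonormal.countable {E ι : Type*} [NormedAddCommGroup E] [InnerProductSpace ℂ E]
    [TopologicalSpace.SeparableSpace E] {v : ι → E} (hv : Orthonormal ℂ v) : Countable ι := by
  refine Pairwise.countable_of_isOpen_disjoint (s := fun i => Metric.ball (v i) (1 / 2))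
    (fun i j hij => Metric.ball_disjoint_ball ?_) (fun i => Metric.isOpen_ball)
    fun i => ⟨v i, Metric.mem_ball_self (by norm_num)⟩
  have h := norm_sub_sq (𝕜 := ℂ) (v i) (v j)
  rw [hv.2 hij, hv.1 i, hv.1 j] at h
  norm_num at h
  rw [dist_eq_norm]
  nlinarith [norm_nonneg (v i - v j)]

theorem exists_hilbertBasis_nat {E : Type*} [NormedAddCommGroup E] [InnerProductSpace ℂ E]
    [CompleteSpace E] [TopologicalSpace.SeparableSpace E] (h : ¬ FiniteDimensional ℂ E) :
    Nonempty (HilbertBasis ℕ ℂ E) := by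
  obtain ⟨w, b, -⟩ := exists_hilbertBasis ℂ E
  have hc : Countable w := b.orthonormal.countable
  have hi : Infinite w := by
    by_contra hfin
    rw [not_infinite_iff_finite] at hfin
    have := Fintype.ofFinite w
    exact h b.toOrthonormalBasis.toBasis.finiteDimensional_of_finite
  obtain ⟨e⟩ := nonempty_equiv_of_countable (α := ℕ) (β := w)
  refine ⟨HilbertBasis.mk (b.orthonormal.comp e e.injective) ?_⟩
  rw [Set.range_comp, e.surjective.range_eq, Set.image_univ, b.dense_span]

/-- The indicators of the intervals [n, n + 1) form an infinite orthonormal family. -/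
theorem not_finiteDimensional_L2_real :
    ¬ FiniteDimensional ℂ (Lp ℂ 2 (volume : Measure ℝ)) := by
  intro hfin
  let v : ℕ → Lp ℂ 2 (volume : Measure ℝ) := fun n =>
    indicatorConstLp 2 (measurableSet_Ico (a := (n : ℝ)) (b := n + 1)) (by simp) 1
  have hv : Orthonormal ℂ v := by
    refine ⟨fun n => ?_, fun m n hmn => ?_⟩
    · rw [norm_indicatorConstLp (by norm_num) (by norm_num)]
      simp [measureReal_def]
    · change inner ℂ (v m) (v n) = 0
      rw [L2.inner_indicatorConstLp_one, setIntegral_congr_ae (g := fun _ => 0) measurableSet_Ico]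
      · simp
      · filter_upwards [indicatorConstLp_coeFn (p := 2) (μ := (volume : Measure ℝ))
          (hs := measurableSet_Ico (a := (n : ℝ)) (b := n + 1)) (hμs := by simp) (c := (1 : ℂ))]
          with x hx hxm
        rw [hx, Set.indicator_of_notMem]
        intro hxn
        have h1 : (m : ℝ) < n + 1 := hxm.1.trans_lt hxn.2
        have h2 : (n : ℝ) < m + 1 := hxn.1.trans_lt hxm.2
        norm_cast at h1 h2
        omega
  have := hv.linearIndependent.finite
  exact not_finite ℕ

/-! ### The natural representation on the Fourier side -/

namespace AffineLineGroup

open SchwartzMap FourierTransform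

/-- The natural operator on Schwartz functions. -/
def schwartzMap (g : AffineLineGroup) (f : 𝓢(ℝ, ℂ)) : 𝓢(ℝ, ℂ) :=
  (g.factor : ℂ) • compSubConstCLM ℂ g.x
    (compCLMOfContinuousLinearEquiv ℂ (ContinuousLinearEquiv.unitsEquivAut ℝ g.a⁻¹) f)

theorem schwartzMap_apply (g : AffineLineGroup) (f : 𝓢(ℝ, ℂ)) (y : ℝ) :
    g.schwartzMap f y = (g.factor : ℂ) * f (g.invMap y) := by
  simp [schwartzMap, invMap, mul_comm]

theorem naturalMap_toLp (g : AffineLineGroup) (f : 𝓢(ℝ, ℂ)) :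
    g.naturalMap (f.toLp 2) = (g.schwartzMap f).toLp 2 := by
  refine Lp.ext ?_
  filter_upwards [g.naturalMap_apply_ae (f.toLp 2), (g.schwartzMap f).coeFn_toLp 2 volume,
    g.quasiMeasurePreserving_invMap.ae (f.coeFn_toLp 2 volume)] with y h1 h2 h3
  rw [h1, h2, h3, schwartzMap_apply]

/-- The weight `|a|^{1/2} e^{-2πixξ}` of the natural representation on the Fourier side. -/
def dualWeight (g : AffineLineGroup) (ξ : ℝ) : ℂ :=
  ((|(g.a : ℝ)| * g.factor : ℝ) : ℂ) * Complex.exp (((-2 * Real.pi * (g.x * ξ) : ℝ) : ℂ) * Complex.I)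

theorem factor_pos (g : AffineLineGroup) : 0 < g.factor :=
  Real.rpow_pos_of_pos (abs_pos.2 g.a.ne_zero) _

theorem factor_sq (g : AffineLineGroup) : g.factor ^ 2 = |(g.a : ℝ)|⁻¹ := by
  rw [factor, ← Real.rpow_natCast, ← Real.rpow_mul (abs_nonneg _), ← Real.rpow_neg_one]
  norm_num

theorem measurable_dualWeight (g : AffineLineGroup) : Measurable g.dualWeight := by
  unfold dualWeight; fun_prop

theorem norm_dualWeight (g : AffineLineGroup) (ξ : ℝ) :
    ‖g.dualWeight ξ‖ = |(g.a : ℝ)| * g.factor := by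
  rw [dualWeight, norm_mul, Complex.norm_exp_ofReal_mul_I, mul_one, Complex.norm_real,
    Real.norm_of_nonneg (mul_nonneg (abs_nonneg _) g.factor_pos.le)]

theorem enorm_dualWeight_sq (g : AffineLineGroup) (ξ : ℝ) :
    ‖g.dualWeight ξ‖ₑ ^ 2 = ENNReal.ofReal |(g.a : ℝ)| := by
  rw [← ofReal_norm, norm_dualWeight, ← ENNReal.ofReal_pow (by have := g.factor_pos; positivity),
    mul_pow, factor_sq, pow_two, mul_assoc, mul_inv_cancel₀ (abs_ne_zero.2 g.a.ne_zero), mul_one]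

/-- Substitute y = x + a t in the Fourier integral: the translation becomes a phase, and the
dilation passes to the frequency with Jacobian |a|. -/
theorem fourier_schwartzMap (g : AffineLineGroup) (f : 𝓢(ℝ, ℂ)) (ξ : ℝ) :
    𝓕 (g.schwartzMap f) ξ = g.dualWeight ξ * 𝓕 f (g.a * ξ) := by
  have ha := g.a.ne_zero
  rw [fourier_coe, fourier_coe, Real.fourier_real_eq_integral_exp_smul,
    Real.fourier_real_eq_integral_exp_smul]
  have h1 : ∀ y : ℝ, Complex.exp (↑(-2 * Real.pi * y * ξ) * Complex.I) • g.schwartzMap f y =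
      (fun u : ℝ => (fun t : ℝ => Complex.exp (↑(-2 * Real.pi * (g.x + g.a * t) * ξ) * Complex.I) •
        ((g.factor : ℂ) * f t)) ((g.a : ℝ)⁻¹ * u)) (y - g.x) := by
    intro y
    simp only [schwartzMap_apply, invMap]
    rw [mul_inv_cancel_left₀ ha, add_sub_cancel]
  simp only [h1]
  rw [integral_sub_right_eq_self (fun u : ℝ => (fun t : ℝ =>
      Complex.exp (↑(-2 * Real.pi * (g.x + g.a * t) * ξ) * Complex.I) •
        ((g.factor : ℂ) * f t)) ((g.a : ℝ)⁻¹ * u)) g.x,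
    Measure.integral_comp_mul_left (fun t : ℝ =>
      Complex.exp (↑(-2 * Real.pi * (g.x + g.a * t) * ξ) * Complex.I) •
        ((g.factor : ℂ) * f t)), inv_inv, dualWeight, ← integral_const_mul, Complex.real_smul,
    ← integral_const_mul]
  refine integral_congr_ae (.of_forall fun t => ?_)
  have h2 : Complex.exp (↑(-2 * Real.pi * (g.x + g.a * t) * ξ) * Complex.I) =
      Complex.exp (((-2 * Real.pi * (g.x * ξ) : ℝ) : ℂ) * Complex.I) *
        Complex.exp (↑(-2 * Real.pi * t * (g.a * ξ)) * Complex.I) := by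
    rw [← Complex.exp_add]
    congr 1
    push_cast
    ring
  simp only [h2, smul_eq_mul]
  push_cast
  ring

theorem map_mul_left_volume (g : AffineLineGroup) :
    Measure.map (fun ξ : ℝ => g.a * ξ) volume = ENNReal.ofReal |(g.a : ℝ)|⁻¹ • volume := by
  rw [Real.map_volume_mul_left g.a.ne_zero, abs_inv]

theorem isWeightedPreserving_dual (g : AffineLineGroup) :
    IsWeightedPreserving (fun ξ : ℝ => g.a * ξ) g.dualWeight volume volume where
  measurable_map := by fun_prop
  measurable_weight := g.measurable_dualWeight
  map_eq := by
    simp only [enorm_dualWeight_sq]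
    rw [withDensity_const, Measure.map_smul, map_mul_left_volume, smul_smul,
      ← ENNReal.ofReal_mul (abs_nonneg _), mul_inv_cancel₀ (abs_ne_zero.2 g.a.ne_zero),
      ENNReal.ofReal_one, one_smul]

/-- The Fourier transform on `L²(ℝ)`. -/
abbrev fourierL2 : Lp ℂ 2 (volume : Measure ℝ) ≃ₗᵢ[ℂ] Lp ℂ 2 (volume : Measure ℝ) :=
  Lp.fourierTransformₗᵢ ℝ ℂ

/-- Both sides are continuous in `f`, so it suffices to treat Schwartz functions, where the Fourier
transform is an integral. -/
theorem fourierL2_naturalMap (g : AffineLineGroup) (f : Lp ℂ 2 (volume : Measure ℝ)) :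
    fourierL2 (g.naturalMap f) = g.isWeightedPreserving_dual.weightedComp (fourierL2 f) := by
  refine (denseRange_toLpCLM (E := ℝ) (F := ℂ) (μ := volume)
    (p := 2) ENNReal.ofNat_ne_top).induction_on f
    (isClosed_eq (by fun_prop) (by fun_prop)) fun φ => ?_
  change fourierL2 (g.naturalMap (φ.toLp 2)) =
    g.isWeightedPreserving_dual.weightedComp (fourierL2 (φ.toLp 2))
  rw [naturalMap_toLp]
  have h : ∀ φ : 𝓢(ℝ, ℂ), fourierL2 (φ.toLp 2) = (𝓕 φ).toLp 2 := toLp_fourier_eq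
  rw [h, h]
  refine Lp.ext (((𝓕 (g.schwartzMap φ)).coeFn_toLp 2 volume).trans ?_)
  refine Filter.EventuallyEq.trans ?_
    (g.isWeightedPreserving_dual.weightedComp_ae_of_ae ((𝓕 φ).coeFn_toLp 2 volume)).symm
  exact .of_forall fun ξ => g.fourier_schwartzMap φ ξ

end AffineLineGroup

/-! ### Irreducibility -/

open SchwartzMap FourierTransform ContDiff in
-- Any test function φ is the Fourier transform of the Schwartz function 𝓕⁻ φ. Moving the transform
-- across the integral, ∫ k φ = ∫ (𝓕 k)(𝓕⁻ φ) = 0.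
theorem Real.ae_eq_zero_of_fourier_eq_zero {k : ℝ → ℂ} (hk : Integrable k)
    (h : ∀ ξ, 𝓕 k ξ = 0) : k =ᵐ[volume] 0 := by
  refine ae_eq_zero_of_integral_contDiff_smul_eq_zero hk.locallyIntegrable fun g hg hgs => ?_
  have hg₁ : HasCompactSupport (Complex.ofRealCLM ∘ g) := hgs.comp_left rfl
  have hg₂ : ContDiff ℝ ∞ (Complex.ofRealCLM ∘ g) := by fun_prop
  set φ : 𝓢(ℝ, ℂ) := hg₁.toSchwartzMap hg₂
  have h1 := VectorFourier.integral_fourierIntegral_smul_eq_flip (L := innerₗ ℝ) (μ := volume)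
    (ν := volume) Real.continuous_fourierChar continuous_inner hk (𝓕⁻ φ).integrable
  have h2 : ∀ x, VectorFourier.fourierIntegral Real.fourierChar volume (innerₗ ℝ).flip
      (𝓕⁻ φ : 𝓢(ℝ, ℂ)) x = φ x := by
    intro x
    rw [flip_innerₗ]
    change 𝓕 ((𝓕⁻ φ : 𝓢(ℝ, ℂ)) : ℝ → ℂ) x = φ x
    rw [← fourier_coe, fourier_fourierInv_eq]
  simp only [h2] at h1
  have h3 : ∀ ξ, VectorFourier.fourierIntegral Real.fourierChar volume (innerₗ ℝ) k ξ = 0 := h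
  simp only [h3, zero_smul, integral_zero] at h1
  rw [h1]
  refine integral_congr_ae (.of_forall fun x => ?_)
  change (g x) • k x = k x • ((g x : ℝ) : ℂ)
  rw [Complex.real_smul, smul_eq_mul, mul_comm]

/-- If `F (a ξ) G (ξ)` vanishes almost everywhere for all `a ≠ 0`, then `F = 0` or `G = 0`. -/
theorem ae_eq_zero_or_ae_eq_zero_of_dilation {F G : ℝ → ℂ} (hF : Measurable F) (hG : Measurable G)
    (h : ∀ a : ℝ, a ≠ 0 → ∀ᵐ ξ : ℝ, F (a * ξ) = 0 ∨ G ξ = 0) :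
    F =ᵐ[volume] 0 ∨ G =ᵐ[volume] 0 := by
  have h1 : ∀ᵐ a : ℝ, ∀ᵐ ξ : ℝ, F (a * ξ) = 0 ∨ G ξ = 0 := by
    filter_upwards [Measure.ae_ne volume (0 : ℝ)] with a ha using h a ha
  have hm : MeasurableSet {z : ℝ × ℝ | F (z.1 * z.2) = 0 ∨ G z.2 = 0} :=
    (measurableSet_eq_fun (by fun_prop) measurable_const).union
      (measurableSet_eq_fun (by fun_prop) measurable_const)
  -- After the exchange, a single ξ ≠ 0 with G ξ ≠ 0 can be fixed such that F(aξ) = 0 for almost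
  -- every a. As a ↦ aξ is a nonsingular dilation, F = 0 almost everywhere.
  rw [Measure.ae_ae_comm hm] at h1
  by_contra! hne
  obtain ⟨hF0, hG0⟩ := hne
  have h2 : ∃ᶠ ξ in ae volume, G ξ ≠ 0 := fun h => hG0 (by
    filter_upwards [h] with ξ hξ using not_not.1 hξ)
  obtain ⟨ξ, hGξ, hξ, hξ0⟩ := (h2.and_eventually
    (h1.and (Measure.ae_ne volume (0 : ℝ)))).exists
  have h3 : ∀ᵐ a : ℝ, F (a * ξ) = 0 := by
    filter_upwards [hξ] with a ha using ha.resolve_right hGξ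
  have hq : Measure.QuasiMeasurePreserving (fun c : ℝ => c * ξ⁻¹) volume volume :=
    ⟨by fun_prop, by
      rw [Real.map_volume_mul_right (inv_ne_zero hξ0)]
      exact Measure.smul_absolutelyContinuous⟩
  refine hF0 ?_
  filter_upwards [hq.ae h3] with c hc
  rwa [inv_mul_cancel_right₀ hξ0] at hc

namespace AffineLineGroup

open FourierTransform

/-- By Plancherel and the formula for ρ̂: for fixed `g.a`, the coefficient as a function of `g.x`
is, up to a nonzero constant and a sign in the variable, one Fourier transform. -/
theorem inner_naturalMap_eq (g : AffineLineGroup) (f h : Lp ℂ 2 (volume : Measure ℝ)) :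
    inner ℂ (g.naturalMap f) h =
      ((|(g.a : ℝ)| * g.factor : ℝ) : ℂ) * 𝓕 (fun ξ => fourierL2 h ξ *
        (starRingEnd ℂ) (fourierL2 f (g.a * ξ))) (-g.x) := by
  rw [← fourierL2.inner_map_map, fourierL2_naturalMap, L2.inner_def,
    Real.fourier_real_eq_integral_exp_smul, ← integral_const_mul]
  refine integral_congr_ae ?_
  filter_upwards [g.isWeightedPreserving_dual.weightedComp_ae (fourierL2 f)] with ξ hξ
  rw [hξ, RCLike.inner_apply, map_mul, dualWeight, map_mul, Complex.conj_ofReal,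
    ← Complex.exp_conj, map_mul, Complex.conj_ofReal, Complex.conj_I]
  have : ((-2 * Real.pi * (g.x * ξ) : ℝ) : ℂ) * -Complex.I =
      ((-2 * Real.pi * ξ * -g.x : ℝ) : ℂ) * Complex.I := by
    push_cast; ring
  rw [this, smul_eq_mul]
  ring

theorem eq_zero_or_eq_zero_of_inner_naturalMap (f h : Lp ℂ 2 (volume : Measure ℝ))
    (hfh : ∀ g : AffineLineGroup, inner ℂ (g.naturalMap f) h = 0) : f = 0 ∨ h = 0 := by
  have key : ∀ a : ℝ, a ≠ 0 → ∀ᵐ ξ : ℝ, fourierL2 f (a * ξ) = 0 ∨ fourierL2 h ξ = 0 := by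
    intro a ha
    have hint : Integrable fun ξ => fourierL2 h ξ * (starRingEnd ℂ) (fourierL2 f (a * ξ)) := by
      have hq : MemLp (fun ξ => fourierL2 f (a * ξ)) 2 volume :=
        ((Lp.memLp (fourierL2 f)).smul_measure (c := ENNReal.ofReal |a⁻¹|)
          ENNReal.ofReal_ne_top).comp_measurePreserving
          ⟨by fun_prop, Real.map_volume_mul_left ha⟩
      exact (Lp.memLp (fourierL2 h)).integrable_mul hq.star
    have h0 := Real.ae_eq_zero_of_fourier_eq_zero hint fun x => by
      -- The translation is -x because the coefficient formula evaluates the transform at `-g.x`.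
      have h1 := hfh ⟨-x, Units.mk0 a ha⟩
      rw [inner_naturalMap_eq] at h1
      simp only [Units.val_mk0, neg_neg] at h1
      refine (mul_eq_zero.1 h1).resolve_left ?_
      exact_mod_cast (mul_pos (abs_pos.2 ha) (factor_pos _)).ne'
    filter_upwards [h0] with ξ hξ
    rcases mul_eq_zero.1 hξ with h1 | h1
    · exact Or.inr h1
    · exact Or.inl (by simpa using h1)
  have hz : ∀ f : Lp ℂ 2 (volume : Measure ℝ), fourierL2 f =ᵐ[volume] 0 → f = 0 := fun f hf =>
    fourierL2.map_eq_zero_iff.1 ((Lp.eq_zero_iff_ae_eq_zero).2 hf)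
  exact (ae_eq_zero_or_ae_eq_zero_of_dilation (Lp.stronglyMeasurable _).measurable
    (Lp.stronglyMeasurable _).measurable key).imp (hz f) (hz h)

/-- A closed invariant subspace other than 0 and the whole space would supply nonzero f ∈ S and h ∈
Sᗮ, with h orthogonal to the whole orbit of f. -/
theorem natural_isIrreducible : natural.IsIrreducible := by
  refine ⟨?_, fun S hS hinv => ?_⟩
  · by_contra hn
    rw [not_nontrivial_iff_subsingleton] at hn
    exact not_finiteDimensional_L2_real inferInstance
  · by_contra! hne
    obtain ⟨f, hfS, hf0⟩ := (Submodule.ne_bot_iff S).1 hne.1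
    have : CompleteSpace S := hS.completeSpace_coe
    obtain ⟨h, hhS, hh0⟩ := (Submodule.ne_bot_iff Sᗮ).1
      (fun h => hne.2 ((Submodule.orthogonal_eq_bot_iff).1 h))
    exact (eq_zero_or_eq_zero_of_inner_naturalMap f h fun g =>
      (Submodule.mem_orthogonal S h).1 hhS _ (hinv g f hfS)).elim hf0 hh0

end AffineLineGroup

/-! ### The left Haar measure in plane coordinates -/

namespace AffineLineGroup

/-- The embedding `[x, a] ↦ (x, a)` of `G₁` into the plane. -/
def toPlane (g : AffineLineGroup) : ℝ × ℝ := (g.x, g.a)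

/-- The map `(x, b) ↦ [x, b]`, with the junk value `[x, 1]` for `b = 0`. -/
def ofPlane (p : ℝ × ℝ) : AffineLineGroup :=
  ⟨p.1, if h : p.2 = 0 then 1 else Units.mk0 p.2 h⟩

theorem toPlane_ofPlane {p : ℝ × ℝ} (hp : p.2 ≠ 0) : toPlane (ofPlane p) = p := by
  simp [toPlane, ofPlane, hp]

theorem ofPlane_toPlane (g : AffineLineGroup) : ofPlane (toPlane g) = g := by
  simp [toPlane, ofPlane]

theorem isOpenEmbedding_toPlane : Topology.IsOpenEmbedding toPlane :=
  (Topology.IsOpenEmbedding.id.prodMap Units.isOpenEmbedding_val).comp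
    homeoProd.isOpenEmbedding

theorem measurable_toPlane : Measurable toPlane := isOpenEmbedding_toPlane.continuous.measurable

theorem measurable_ofPlane : Measurable ofPlane := by
  rw [← isOpenEmbedding_toPlane.measurableEmbedding.measurable_comp_iff]
  have h : toPlane ∘ ofPlane = fun p : ℝ × ℝ => (p.1, if p.2 = 0 then 1 else p.2) := by
    funext p
    by_cases hp : p.2 = 0 <;> simp [toPlane, ofPlane, hp]
  rw [h]
  exact measurable_fst.prodMk (Measurable.ite (measurableSet_eq_fun measurable_snd
    measurable_const) measurable_const measurable_snd)

/-- The line b = 0 missed by `toPlane` is null, so the junk value of `ofPlane` there never matters.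
-/
theorem ae_snd_ne_zero :
    ∀ᵐ p ∂(volume : Measure ℝ).prod (volume : Measure ℝ), p.2 ≠ 0 :=
  Measure.quasiMeasurePreserving_snd.ae (Measure.ae_ne volume (0 : ℝ))

theorem ae_fst_ne_zero :
    ∀ᵐ p ∂(volume : Measure ℝ).prod (volume : Measure ℝ), p.1 ≠ 0 :=
  Measure.quasiMeasurePreserving_fst.ae (Measure.ae_ne volume (0 : ℝ))

/-- The affine action of `G₁` on the plane that corresponds to left multiplication. -/
def planeMap (g : AffineLineGroup) : ℝ × ℝ → ℝ × ℝ :=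
  Prod.map (fun y => g.x + g.a * y) fun b => g.a * b

theorem measurable_planeMap (g : AffineLineGroup) : Measurable g.planeMap := by
  unfold planeMap; fun_prop

theorem mul_ofPlane (g : AffineLineGroup) {p : ℝ × ℝ} (hp : p.2 ≠ 0) :
    g * ofPlane p = ofPlane (g.planeMap p) := by
  apply isOpenEmbedding_toPlane.injective
  rw [toPlane_ofPlane (mul_ne_zero g.a.ne_zero hp)]
  simp [toPlane, ofPlane, planeMap, hp, Prod.map]

theorem map_planeMap (g : AffineLineGroup) :
    Measure.map g.planeMap ((volume : Measure ℝ).prod volume) =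
      (ENNReal.ofReal |(g.a : ℝ)|⁻¹ ^ 2) • (volume : Measure ℝ).prod volume := by
  have h1 : Measure.map (fun y : ℝ => g.x + g.a * y) volume =
      ENNReal.ofReal |(g.a : ℝ)|⁻¹ • volume := by
    have h := Measure.map_map (μ := (volume : Measure ℝ)) (g := fun y => g.x + y)
      (f := fun y => g.a * y) (by fun_prop) (by fun_prop)
    rw [map_mul_left_volume, Measure.map_smul, map_add_left_eq_self] at h
    exact h.symm
  rw [planeMap, ← Measure.map_prod_map _ _ (by fun_prop) (by fun_prop), h1, map_mul_left_volume,
    Measure.prod_smul_left, Measure.prod_smul_right, smul_smul, pow_two]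

/-- The weight `|b|⁻¹` of the left Haar measure. -/
def haarWeight (p : ℝ × ℝ) : ℂ := ((|p.2|⁻¹ : ℝ) : ℂ)

theorem measurable_haarWeight : Measurable haarWeight := by unfold haarWeight; fun_prop

theorem haarWeight_planeMap (g : AffineLineGroup) (p : ℝ × ℝ) :
    haarWeight (g.planeMap p) = ((|(g.a : ℝ)|⁻¹ : ℝ) : ℂ) * haarWeight p := by
  simp [haarWeight, planeMap, abs_mul, mul_comm]

/-- The measure `|b|⁻² dx db` on the plane. -/
def planeHaar : Measure (ℝ × ℝ) :=
  ((volume : Measure ℝ).prod volume).withDensity fun p => ‖haarWeight p‖ₑ ^ 2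

theorem measurable_enorm_haarWeight_sq : Measurable fun p => ‖haarWeight p‖ₑ ^ 2 :=
  measurable_haarWeight.enorm.pow_const 2

/-- Pushing Lebesgue measure forward along the action produces the factor |a|⁻², which the change of
the density |b|⁻² under b ↦ ab compensates exactly. -/
theorem map_planeMap_planeHaar (g : AffineLineGroup) :
    Measure.map g.planeMap planeHaar = planeHaar := by
  have ha : 0 < |(g.a : ℝ)| := abs_pos.2 g.a.ne_zero
  have hc : ENNReal.ofReal |(g.a : ℝ)| ^ 2 * ENNReal.ofReal |(g.a : ℝ)|⁻¹ ^ 2 = 1 := by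
    rw [← mul_pow, ← ENNReal.ofReal_mul ha.le, mul_inv_cancel₀ ha.ne']
    simp
  have h1 : ∀ p, ‖haarWeight p‖ₑ ^ 2 =
      ENNReal.ofReal |(g.a : ℝ)| ^ 2 * ‖haarWeight (g.planeMap p)‖ₑ ^ 2 := by
    intro p
    have h2 : ‖((|(g.a : ℝ)|⁻¹ : ℝ) : ℂ)‖ₑ = ENNReal.ofReal |(g.a : ℝ)|⁻¹ := by
      rw [← ofReal_norm, Complex.norm_real, Real.norm_of_nonneg (inv_nonneg.2 ha.le)]
    rw [haarWeight_planeMap, enorm_mul, mul_pow, ← mul_assoc, h2, hc, one_mul]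
  ext s hs
  have hs' := g.measurable_planeMap hs
  rw [Measure.map_apply g.measurable_planeMap hs, planeHaar, withDensity_apply _ hs',
    withDensity_apply _ hs, setLIntegral_congr_fun hs' (fun p _ => h1 p), lintegral_const_mul]
  · rw [← setLIntegral_map hs measurable_enorm_haarWeight_sq g.measurable_planeMap,
      map_planeMap, Measure.restrict_smul, lintegral_smul_measure, smul_eq_mul, ← mul_assoc, hc,
      one_mul]
  · exact measurable_enorm_haarWeight_sq.comp g.measurable_planeMap

theorem planeHaar_ae_snd_ne_zero : ∀ᵐ p ∂planeHaar, p.2 ≠ 0 :=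
  (withDensity_absolutelyContinuous _ _).ae_le ae_snd_ne_zero

/-- The left Haar measure `|a|⁻² dx da` of `G₁`. -/
def haarAffine : Measure AffineLineGroup := planeHaar.map ofPlane

theorem haarAffine_apply {s : Set AffineLineGroup} (hs : MeasurableSet s) :
    haarAffine s = planeHaar (toPlane '' s) := by
  rw [haarAffine, Measure.map_apply measurable_ofPlane hs]
  refine measure_congr ?_
  filter_upwards [planeHaar_ae_snd_ne_zero] with p hp
  refine propext ⟨fun h => ⟨ofPlane p, h, toPlane_ofPlane hp⟩, ?_⟩
  rintro ⟨g, hg, rfl⟩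
  change ofPlane (toPlane g) ∈ s
  rwa [ofPlane_toPlane]

instance : haarAffine.IsMulLeftInvariant where
  map_mul_left_eq_self g := by
    rw [haarAffine, Measure.map_map (measurable_const_mul g) measurable_ofPlane,
      Measure.map_congr (g := ofPlane ∘ g.planeMap),
      ← Measure.map_map measurable_ofPlane g.measurable_planeMap, map_planeMap_planeHaar]
    filter_upwards [planeHaar_ae_snd_ne_zero] with p hp using g.mul_ofPlane hp

/-- On a compact set that avoids the line b = 0 the density is continuous, hence bounded. -/
theorem planeHaar_lt_top {C : Set (ℝ × ℝ)} (hC : IsCompact C) (h0 : ∀ p ∈ C, p.2 ≠ 0) :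
    planeHaar C < ∞ := by
  have hcont : ContinuousOn haarWeight C := by
    refine Complex.continuous_ofReal.comp_continuousOn ?_
    exact (continuous_abs.comp continuous_snd).continuousOn.inv₀ fun p hp => abs_ne_zero.2 (h0 p hp)
  obtain ⟨B, hB⟩ := hC.exists_bound_of_continuousOn hcont
  rw [planeHaar, withDensity_apply _ hC.measurableSet]
  refine (setLIntegral_mono (g := fun _ => ENNReal.ofReal B ^ 2) measurable_const
    fun p hp => ?_).trans_lt ?_
  · gcongr
    rw [← ofReal_norm]
    exact ENNReal.ofReal_le_ofReal (hB p hp)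
  · rw [setLIntegral_const]
    exact ENNReal.mul_lt_top (by finiteness) hC.measure_lt_top

instance : haarAffine.IsHaarMeasure where
  lt_top_of_isCompact K hK := by
    rw [haarAffine_apply hK.measurableSet]
    refine planeHaar_lt_top (hK.image isOpenEmbedding_toPlane.continuous) ?_
    rintro _ ⟨g, -, rfl⟩
    exact g.a.ne_zero
  open_pos U hU hne := by
    rw [haarAffine_apply hU.measurableSet, planeHaar,
      ← pos_iff_ne_zero, withDensity_apply _
        (isOpenEmbedding_toPlane.isOpenMap U hU).measurableSet,
      setLIntegral_pos_iff measurable_enorm_haarWeight_sq]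
    have hsub : toPlane '' U ⊆ Function.support fun p => ‖haarWeight p‖ₑ ^ 2 := by
      rintro _ ⟨g, -, rfl⟩
      simp [haarWeight, toPlane]
    rw [Set.inter_eq_self_of_subset_right hsub]
    exact (isOpenEmbedding_toPlane.isOpenMap U hU).measure_pos _ (hne.image _)

/-- By uniqueness of Haar measure, `μ` is a positive multiple of `haarAffine`. The weight contains
the square root of that multiple, since weights enter squared. -/
theorem exists_isWeightedPreserving_ofPlane (μ : Measure AffineLineGroup) [μ.IsHaarMeasure] :
    ∃ c : ℝ, 0 < c ∧ IsWeightedPreserving ofPlane (fun p => (c : ℂ) * haarWeight p)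
      ((volume : Measure ℝ).prod volume) μ := by
  have hμ := Measure.isMulLeftInvariant_eq_smul μ haarAffine
  have hpos := Measure.haarScalarFactor_pos_of_isHaarMeasure μ haarAffine
  set c := Measure.haarScalarFactor μ haarAffine
  refine ⟨√c, Real.sqrt_pos.2 (by exact_mod_cast hpos), measurable_ofPlane,
    measurable_haarWeight.const_mul _, ?_⟩
  have h1 : ∀ p, ‖((√c : ℝ) : ℂ) * haarWeight p‖ₑ ^ 2 = (c : ℝ≥0∞) * ‖haarWeight p‖ₑ ^ 2 := by
    intro p
    rw [enorm_mul, mul_pow, ← ofReal_norm, Complex.norm_real,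
      Real.norm_of_nonneg (Real.sqrt_nonneg _), ← ENNReal.ofReal_pow (Real.sqrt_nonneg _),
      Real.sq_sqrt c.coe_nonneg, ENNReal.ofReal_coe_nnreal]
  simp only [h1]
  conv_rhs => rw [hμ]
  have h2 := withDensity_smul (μ := (volume : Measure ℝ).prod volume) (c : ℝ≥0∞)
    measurable_enorm_haarWeight_sq
  change Measure.map ofPlane (Measure.withDensity _ ((c : ℝ≥0∞) • fun p => ‖haarWeight p‖ₑ ^ 2)) = _
  rw [h2, Measure.map_smul]
  rfl

end AffineLineGroup

/-! ### Square-integrability: the coefficient of y e^{-y²} -/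

namespace AffineLineGroup

theorem integrable_pow_mul_gaussian {b : ℝ} (hb : 0 < b) (n : ℕ) :
    Integrable fun x : ℝ => x ^ n * Real.exp (-b * x ^ 2) := by
  have h := integrable_rpow_mul_exp_neg_mul_sq hb (s := n)
    (by have : (0 : ℝ) ≤ n := n.cast_nonneg
        linarith)
  simpa using h

theorem integral_id_mul_gaussian : ∫ v : ℝ, v * Real.exp (-v ^ 2) = 0 := by
  have h := integral_neg_eq_self (fun v : ℝ => v * Real.exp (-v ^ 2)) volume
  simp only [neg_sq, neg_mul, integral_neg] at h
  linarith

/-- The first Hermite-type function `y e^{-y²}`. -/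
def gaussianMoment (y : ℝ) : ℝ := y * Real.exp (-y ^ 2)

theorem continuous_gaussianMoment : Continuous gaussianMoment := by
  unfold gaussianMoment; fun_prop

theorem memLp_gaussianMoment : MemLp (fun y => (gaussianMoment y : ℂ)) 2 volume := by
  have hc : Continuous fun y => (gaussianMoment y : ℂ) :=
    Complex.continuous_ofReal.comp continuous_gaussianMoment
  refine (memLp_two_iff_integrable_sq_norm hc.aestronglyMeasurable).2 ?_
  refine (integrable_pow_mul_gaussian (b := 2) two_pos 2).congr (.of_forall fun y => ?_)
  simp only [gaussianMoment, Complex.norm_real, Real.norm_eq_abs, sq_abs, mul_pow]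
  rw [← Real.exp_nat_mul]
  congr 2
  push_cast
  ring

/-- Completing the square: y² + (y - x)²/b² = x²/(1 + b²) + v² for y = m + r v, where m = x/(1 + b²)
is the minimiser and r = b/√(1 + b²). The term linear in v integrates to zero by oddness. The second
moment stays unevaluated, as only its sign is needed later. -/
theorem integral_gaussianMoment_mul {b : ℝ} (hb : b ≠ 0) (x : ℝ) :
    ∫ y, gaussianMoment y * gaussianMoment (b⁻¹ * (y - x)) =
      |b / √(1 + b ^ 2)| * (b⁻¹ * Real.exp (-(x ^ 2 / (1 + b ^ 2))) * (b ^ 2 / (1 + b ^ 2)) *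
        ((∫ v : ℝ, v ^ 2 * Real.exp (-v ^ 2)) - x ^ 2 / (1 + b ^ 2) * √Real.pi)) := by
  have hs2 : √(1 + b ^ 2) ^ 2 = 1 + b ^ 2 := Real.sq_sqrt (by positivity)
  have hs : √(1 + b ^ 2) ≠ 0 := (Real.sqrt_pos.2 (by positivity)).ne'
  have hs0 : 1 + b ^ 2 ≠ 0 := by positivity
  set r := b / √(1 + b ^ 2) with hr
  have hr0 : r ≠ 0 := div_ne_zero hb hs
  have hr2 : r ^ 2 = b ^ 2 / (1 + b ^ 2) := by rw [hr, div_pow, hs2]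
  set m := x / (1 + b ^ 2) with hm
  set F : ℝ → ℝ := fun y => gaussianMoment y * gaussianMoment (b⁻¹ * (y - x)) with hF
  have h1 : ∫ v, F (m + r * v) = |r|⁻¹ * ∫ y, F y := by
    rw [Measure.integral_comp_mul_left (fun y => F (m + y)), integral_add_left_eq_self, abs_inv,
      smul_eq_mul]
  have h2 : ∀ v, F (m + r * v) = b⁻¹ * Real.exp (-(x ^ 2 / (1 + b ^ 2))) *
      ((r ^ 2 * (v ^ 2 * Real.exp (-1 * v ^ 2)) + r * (2 * m - x) * (v * Real.exp (-v ^ 2))) -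
        x ^ 2 / (1 + b ^ 2) * r ^ 2 * Real.exp (-1 * v ^ 2)) := by
    intro v
    have e1 : Real.exp (-(m + r * v) ^ 2) * Real.exp (-(b⁻¹ * (m + r * v - x)) ^ 2) =
        Real.exp (-(x ^ 2 / (1 + b ^ 2))) * Real.exp (-v ^ 2) := by
      rw [← Real.exp_add, ← Real.exp_add]
      congr 1
      have : (m + r * v) ^ 2 + (b⁻¹ * (m + r * v - x)) ^ 2 =
          (m ^ 2 + (m - x) ^ 2 / b ^ 2) + 2 * r * v * (m + (m - x) / b ^ 2) +
            r ^ 2 * (1 + 1 / b ^ 2) * v ^ 2 := by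
        field_simp
        ring
      have t1 : m ^ 2 + (m - x) ^ 2 / b ^ 2 = x ^ 2 / (1 + b ^ 2) := by
        rw [hm]; field_simp; ring
      have t2 : m + (m - x) / b ^ 2 = 0 := by
        rw [hm]; field_simp; ring
      have t3 : r ^ 2 * (1 + 1 / b ^ 2) = 1 := by
        rw [hr2]; field_simp; ring
      rw [t1, t2, t3] at this
      linarith
    have e2 : (m + r * v) * (m + r * v - x) =
        r ^ 2 * v ^ 2 + r * (2 * m - x) * v - x ^ 2 / (1 + b ^ 2) * r ^ 2 := by
      have : m * (m - x) = - (x ^ 2 / (1 + b ^ 2) * r ^ 2) := by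
        rw [hr2, hm]; field_simp; ring
      linear_combination this
    simp only [hF, gaussianMoment, neg_one_mul]
    linear_combination (m + r * v) * (b⁻¹ * (m + r * v - x)) * e1 +
      b⁻¹ * Real.exp (-(x ^ 2 / (1 + b ^ 2))) * Real.exp (-v ^ 2) * e2
  have i0 : Integrable fun v : ℝ => Real.exp (-1 * v ^ 2) := integrable_exp_neg_mul_sq one_pos
  have i1 : Integrable fun v : ℝ => v * Real.exp (-v ^ 2) := by
    simpa using integrable_pow_mul_gaussian one_pos 1
  have i2 : Integrable fun v : ℝ => v ^ 2 * Real.exp (-1 * v ^ 2) :=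
    integrable_pow_mul_gaussian one_pos 2
  have i3 : Integrable fun v : ℝ => r ^ 2 * (v ^ 2 * Real.exp (-1 * v ^ 2)) +
      r * (2 * m - x) * (v * Real.exp (-v ^ 2)) := (i2.const_mul _).add (i1.const_mul _)
  have h3 : ∫ y, F y = |r| * ∫ v, F (m + r * v) := by
    rw [h1, mul_inv_cancel_left₀ (abs_ne_zero.2 hr0)]
  rw [h3]
  congr 1
  simp only [h2]
  rw [integral_const_mul, integral_sub i3 (i0.const_mul _),
    integral_add (i2.const_mul _) (i1.const_mul _), integral_const_mul, integral_const_mul,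
    integral_const_mul, integral_id_mul_gaussian, integral_gaussian, ← hr2]
  simp only [neg_one_mul, div_one]
  ring

/-- |A - tB| ≤ (A + B)(1 + t), and (1 + t)² ≤ 2(1 + t + t²/2) ≤ 2 e^t. -/
theorem exp_neg_mul_le {A B t : ℝ} (hA : 0 ≤ A) (hB : 0 ≤ B) (ht : 0 ≤ t) :
    Real.exp (-t) * |A - t * B| ≤ 2 * (A + B) / (1 + t) := by
  have h1 : |A - t * B| ≤ (A + B) * (1 + t) := by
    rw [abs_le]
    constructor <;> nlinarith [mul_nonneg ht hA, mul_nonneg ht hB]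
  have h2 := Real.quadratic_le_exp_of_nonneg ht
  rw [Real.exp_neg, le_div_iff₀ (by positivity), inv_mul_eq_div, div_mul_eq_mul_div,
    div_le_iff₀ (Real.exp_pos t)]
  calc |A - t * B| * (1 + t) ≤ (A + B) * (1 + t) * (1 + t) := by gcongr
    _ ≤ 2 * (A + B) * (1 + t + t ^ 2 / 2) := by nlinarith [add_nonneg hA hB]
    _ ≤ 2 * (A + B) * Real.exp t := by gcongr

/-- The factor |b|³ is what will cancel |b|⁻² from the Haar density and |b|⁻¹ from the squared
normalisation of ρ, leaving an integrable product of functions of x and of b. -/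
theorem exists_integral_gaussianMoment_mul_sq_le : ∃ K : ℝ, ∀ b : ℝ, b ≠ 0 → ∀ x : ℝ,
    (∫ y, gaussianMoment y * gaussianMoment (b⁻¹ * (y - x))) ^ 2 ≤
      K ^ 2 * (|b| ^ 3 * ((1 + x ^ 2)⁻¹ * (1 + b ^ 2)⁻¹)) := by
  set M := ∫ v : ℝ, v ^ 2 * Real.exp (-v ^ 2)
  have hM : 0 ≤ M := integral_nonneg fun v => by positivity
  refine ⟨2 * (M + √Real.pi), fun b hb x => ?_⟩
  rw [integral_gaussianMoment_mul hb x]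
  set t := x ^ 2 / (1 + b ^ 2) with ht
  have ht0 : 0 ≤ t := by positivity
  have h1 := exp_neg_mul_le hM (Real.sqrt_nonneg Real.pi) ht0
  set K := 2 * (M + √Real.pi)
  have hK : 0 ≤ K := by positivity
  have hs2 : √(1 + b ^ 2) ^ 2 = 1 + b ^ 2 := Real.sq_sqrt (by positivity)
  have h2 : (Real.exp (-t) * (M - t * √Real.pi)) ^ 2 ≤ (K / (1 + t)) ^ 2 := by
    rw [mul_pow, ← sq_abs (M - t * _), ← mul_pow]
    gcongr
  have h3 : (|b / √(1 + b ^ 2)| * (b⁻¹ * Real.exp (-t) * (b ^ 2 / (1 + b ^ 2)) *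
      (M - t * √Real.pi))) ^ 2 =
      b ^ 4 / (1 + b ^ 2) ^ 3 * (Real.exp (-t) * (M - t * √Real.pi)) ^ 2 := by
    simp only [mul_pow, sq_abs, div_pow, hs2, inv_pow]
    field_simp
  rw [h3]
  refine (mul_le_mul_of_nonneg_left h2 (by positivity)).trans ?_
  -- One of the two powers of (1 + t)⁻¹ is discarded; the other gives the decay in x, since 1 + x² ≤
  -- (1 + b²)(1 + t), at the price of a factor 1 + b².
  have h4 : (K / (1 + t)) ^ 2 ≤ K ^ 2 * ((1 + b ^ 2) * (1 + x ^ 2)⁻¹) := by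
    rw [div_pow, div_eq_mul_inv]
    refine mul_le_mul_of_nonneg_left ?_ (by positivity)
    rw [← div_eq_mul_inv, inv_le_comm₀ (by positivity) (by positivity), inv_div]
    have h5 : (1 + x ^ 2) / (1 + b ^ 2) ≤ 1 + t := by
      rw [ht, div_le_iff₀ (by positivity), add_mul, div_mul_cancel₀ _ (by positivity)]
      nlinarith [sq_nonneg b]
    nlinarith
  refine (mul_le_mul_of_nonneg_left h4 (by positivity)).trans ?_
  -- Of the four powers of |b|, three are kept and the fourth is absorbed by a factor 1 + b².
  have h6 : |b| ≤ 1 + b ^ 2 := by nlinarith [sq_abs b, sq_nonneg (|b| - 1)]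
  have h7 : b ^ 4 = |b| ^ 3 * |b| := by
    rw [← pow_succ, Even.pow_abs (by decide)]
  calc b ^ 4 / (1 + b ^ 2) ^ 3 * (K ^ 2 * ((1 + b ^ 2) * (1 + x ^ 2)⁻¹))
      = K ^ 2 * (|b| ^ 3 * ((1 + x ^ 2)⁻¹ * (|b| / (1 + b ^ 2) ^ 2))) := by
        rw [h7]; field_simp
    _ ≤ K ^ 2 * (|b| ^ 3 * ((1 + x ^ 2)⁻¹ * ((1 + b ^ 2) / (1 + b ^ 2) ^ 2))) := by gcongr
    _ = _ := by field_simp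

theorem coeff_gaussianMoment (g : AffineLineGroup) :
    natural.coeff (memLp_gaussianMoment.toLp _) (memLp_gaussianMoment.toLp _) g =
      ((g.factor * ∫ y, gaussianMoment y * gaussianMoment (g.invMap y) : ℝ) : ℂ) := by
  change inner ℂ (g.naturalMap _) _ = _
  rw [L2.inner_def, ← integral_const_mul, ← integral_complex_ofReal]
  refine integral_congr_ae ?_
  filter_upwards [g.naturalMap_apply_ae (memLp_gaussianMoment.toLp _),
    memLp_gaussianMoment.coeFn_toLp,
    g.quasiMeasurePreserving_invMap.ae memLp_gaussianMoment.coeFn_toLp] with y h1 h2 h3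
  rw [h1, h2, h3]
  simp only [RCLike.inner_apply, map_mul, Complex.conj_ofReal]
  push_cast
  ring

theorem natural_isSquareIntegrable (μ : Measure AffineLineGroup) [μ.IsHaarMeasure] :
    natural.IsSquareIntegrable μ := by
  refine ⟨natural_isIrreducible, memLp_gaussianMoment.toLp _, fun h0 => ?_, ?_⟩
  · have h1 := memLp_gaussianMoment.coeFn_toLp.symm.trans ((Lp.eq_zero_iff_ae_eq_zero).1 h0)
    have h2 : (fun y => (gaussianMoment y : ℂ)) = 0 :=
      (Continuous.ae_eq_iff_eq volume (Complex.continuous_ofReal.comp continuous_gaussianMoment)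
        continuous_const).1 h1
    have h3 := congrFun h2 1
    simp [gaussianMoment] at h3
  · set η := memLp_gaussianMoment.toLp _
    have hc : Continuous (natural.coeff η η) := natural.continuous_inner η η
    obtain ⟨c, -, hφ⟩ := exists_isWeightedPreserving_ofPlane μ
    obtain ⟨K, hK⟩ := exists_integral_gaussianMoment_mul_sq_le
    refine ⟨hc.aestronglyMeasurable, ?_⟩
    rw [← hφ.eLpNorm_mul_comp hc.measurable]
    have hm : Measurable fun p => (c : ℂ) * haarWeight p * natural.coeff η η (ofPlane p) :=
      hφ.measurable_weight.mul (hc.measurable.comp hφ.measurable_map)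
    refine ((memLp_two_iff_integrable_sq_norm hm.aestronglyMeasurable).2 ?_).2
    refine Integrable.mono' ((integrable_inv_one_add_sq.mul_prod integrable_inv_one_add_sq).const_mul
      (c ^ 2 * K ^ 2)) (hm.norm.pow_const 2).aestronglyMeasurable ?_
    filter_upwards [ae_snd_ne_zero] with p hp
    have ha : ((ofPlane p).a : ℝ) = p.2 := by simp [ofPlane, hp]
    have hb : 0 < |p.2| := abs_pos.2 hp
    have hinv : (ofPlane p).invMap = fun y => p.2⁻¹ * (y - p.1) := by
      funext y
      rw [invMap, ha]
      rfl
    rw [Real.norm_of_nonneg (sq_nonneg _), coeff_gaussianMoment, norm_mul, norm_mul, haarWeight,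
      Complex.norm_real, Complex.norm_real, Complex.norm_real, mul_pow, mul_pow]
    simp only [Real.norm_eq_abs, sq_abs]
    rw [mul_pow, factor_sq, ha, hinv, inv_pow]
    calc c ^ 2 * (|p.2| ^ 2)⁻¹ * (|p.2|⁻¹ *
        (∫ y, gaussianMoment y * gaussianMoment (p.2⁻¹ * (y - p.1))) ^ 2)
        ≤ c ^ 2 * (|p.2| ^ 2)⁻¹ * (|p.2|⁻¹ *
          (K ^ 2 * (|p.2| ^ 3 * ((1 + p.1 ^ 2)⁻¹ * (1 + p.2 ^ 2)⁻¹)))) := by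
          gcongr
          exact hK p.2 hp p.1
      _ = c ^ 2 * K ^ 2 * ((1 + p.1 ^ 2)⁻¹ * (1 + p.2 ^ 2)⁻¹) := by
          have h3 : (|p.2| ^ 2)⁻¹ * |p.2|⁻¹ * |p.2| ^ 3 = 1 := by field_simp
          linear_combination c ^ 2 * K ^ 2 * ((1 + p.1 ^ 2)⁻¹ * (1 + p.2 ^ 2)⁻¹) * h3

end AffineLineGroup

/-! ### Tensor products of weighted compositions -/

namespace IsWeightedPreserving

variable {X Y X' Y' : Type*} [MeasurableSpace X] [MeasurableSpace Y] [MeasurableSpace X']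
  [MeasurableSpace Y'] {μ : Measure X} {ν : Measure Y} {μ' : Measure X'} {ν' : Measure Y'}
  {φ : X → Y} {w : X → ℂ} {φ' : X' → Y'} {w' : X' → ℂ}

theorem identity (μ : Measure X) : IsWeightedPreserving id (fun _ : X => (1 : ℂ)) μ μ where
  measurable_map := measurable_id
  measurable_weight := measurable_const
  map_eq := by simp

theorem weightedComp_identity (f : Lp ℂ 2 μ) : (identity μ).weightedComp f = f := by
  refine Lp.ext (((identity μ).weightedComp_ae f).trans (.of_forall fun x => ?_))
  simp

theorem prodMap [SigmaFinite μ] [SigmaFinite μ'] (h : IsWeightedPreserving φ w μ ν) (h' : IsWeightedPreserving φ' w' μ' ν') :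
    IsWeightedPreserving (Prod.map φ φ') (fun p => w p.1 * w' p.2) (μ.prod μ') (ν.prod ν') where
  measurable_map := h.measurable_map.prodMap h'.measurable_map
  measurable_weight := (h.measurable_weight.comp measurable_fst).mul
    (h'.measurable_weight.comp measurable_snd)
  map_eq := by
    simp only [enorm_mul, mul_pow]
    rw [← prod_withDensity (h.measurable_weight.enorm.pow_const 2)
      (h'.measurable_weight.enorm.pow_const 2),
      ← Measure.map_prod_map _ _ h.measurable_map h'.measurable_map, h.map_eq, h'.map_eq]

theorem weightedComp_tensorLp [SigmaFinite μ] [SigmaFinite μ'] (h : IsWeightedPreserving φ w μ ν)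
    (h' : IsWeightedPreserving φ' w' μ' ν') (f : Lp ℂ 2 ν) (k : Lp ℂ 2 ν') :
    (h.prodMap h').weightedComp (tensorLp f k) =
      tensorLp (h.weightedComp f) (h'.weightedComp k) := by
  refine Lp.ext (((h.prodMap h').weightedComp_ae_of_ae (tensorLp_ae f k)).trans ?_)
  filter_upwards [tensorLp_ae (h.weightedComp f) (h'.weightedComp k),
    Measure.quasiMeasurePreserving_fst.ae (h.weightedComp_ae f),
    Measure.quasiMeasurePreserving_snd.ae (h'.weightedComp_ae k)] with p h1 h2 h3
  rw [h1, h2, h3, Prod.map_fst, Prod.map_snd]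
  ring

end IsWeightedPreserving

/-! ### Decomposition of the regular representation -/

namespace AffineLineGroup

/-- Lebesgue measure on the plane, as a product measure. -/
abbrev planeVolume : Measure (ℝ × ℝ) := (volume : Measure ℝ).prod volume

theorem isWeightedPreserving_natural (g : AffineLineGroup) :
    IsWeightedPreserving g.invMap (fun _ => (g.factor : ℂ)) volume volume where
  measurable_map := g.measurePreserving_invMap.measurable
  measurable_weight := measurable_const
  map_eq := by
    rw [withDensity_const, Measure.map_smul, g.measurePreserving_invMap.map_eq, smul_smul,
      ← ofReal_norm, Complex.norm_real, Real.norm_of_nonneg g.factor_pos.le,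
      ← ENNReal.ofReal_pow g.factor_pos.le, factor_sq, ← ENNReal.ofReal_mul (by positivity),
      inv_mul_cancel₀ (abs_ne_zero.2 g.a.ne_zero), ENNReal.ofReal_one, one_smul]

theorem weightedComp_natural (g : AffineLineGroup) (f : Lp ℂ 2 (volume : Measure ℝ)) :
    g.isWeightedPreserving_natural.weightedComp f = g.naturalMap f :=
  Lp.ext ((g.isWeightedPreserving_natural.weightedComp_ae f).trans (g.naturalMap_apply_ae f).symm)

/-- The dilation with the same linear part. -/
def dilation (g : AffineLineGroup) : AffineLineGroup := ⟨0, g.a⟩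

theorem factor_dilation (g : AffineLineGroup) : g.dilation.factor = g.factor := rfl

/-- The operator `ρ(g) ⊗ ρ[0, a]` on `L²(ℝ²)`. -/
def planeRegular (g : AffineLineGroup) : Lp ℂ 2 planeVolume →ₗᵢ[ℂ] Lp ℂ 2 planeVolume :=
  (g.isWeightedPreserving_natural.prodMap g.dilation.isWeightedPreserving_natural).weightedComp

/-- The operator `ρ̂(g) ⊗ ρ[0, a]` on `L²(ℝ²)`, with `ρ̂` the Fourier conjugate of `ρ`. -/
def planeDual (g : AffineLineGroup) : Lp ℂ 2 planeVolume →ₗᵢ[ℂ] Lp ℂ 2 planeVolume :=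
  (g.isWeightedPreserving_dual.prodMap g.dilation.isWeightedPreserving_natural).weightedComp

/-- The operator `ρ̂(g) ⊗ 1` on `L²(ℝ²)`, with `ρ̂` the Fourier conjugate of `ρ`. -/
def planeDualOne (g : AffineLineGroup) : Lp ℂ 2 planeVolume →ₗᵢ[ℂ] Lp ℂ 2 planeVolume :=
  (g.isWeightedPreserving_dual.prodMap (IsWeightedPreserving.identity volume)).weightedComp

theorem planeRegular_tensorLp (g : AffineLineGroup) (f k : Lp ℂ 2 (volume : Measure ℝ)) :
    g.planeRegular (tensorLp f k) = tensorLp (g.naturalMap f) (g.dilation.naturalMap k) :=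
  (IsWeightedPreserving.weightedComp_tensorLp g.isWeightedPreserving_natural
    g.dilation.isWeightedPreserving_natural f k).trans
    (by rw [weightedComp_natural, weightedComp_natural])

theorem planeDual_tensorLp (g : AffineLineGroup) (f k : Lp ℂ 2 (volume : Measure ℝ)) :
    g.planeDual (tensorLp (fourierL2 f) k) =
      tensorLp (fourierL2 (g.naturalMap f)) (g.dilation.naturalMap k) :=
  (IsWeightedPreserving.weightedComp_tensorLp g.isWeightedPreserving_dual
    g.dilation.isWeightedPreserving_natural (fourierL2 f) k).trans
    (by rw [weightedComp_natural, fourierL2_naturalMap])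

theorem planeDualOne_tensorLp (g : AffineLineGroup) (f k : Lp ℂ 2 (volume : Measure ℝ)) :
    g.planeDualOne (tensorLp (fourierL2 f) k) = tensorLp (fourierL2 (g.naturalMap f)) k :=
  (IsWeightedPreserving.weightedComp_tensorLp g.isWeightedPreserving_dual
    (IsWeightedPreserving.identity volume) (fourierL2 f) k).trans
    (by rw [IsWeightedPreserving.weightedComp_identity, fourierL2_naturalMap])

/-- `U` restricts to coordinates and multiplies by a constant times |b|⁻¹. Commuting this weight
past the translation costs |a|⁻¹, which is the product of the normalising factors |a|^{-1/2} of ρ(g)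
and ρ[0, a]. -/
theorem exists_unitary_leftRegular (μ : Measure AffineLineGroup) [μ.IsHaarMeasure] :
    ∃ U : Lp ℂ 2 μ ≃ₗᵢ[ℂ] Lp ℂ 2 planeVolume, ∀ g F,
      U ((UnitaryRep.leftRegular μ).toHom g F) = g.planeRegular (U F) := by
  obtain ⟨c, hc, h⟩ := exists_isWeightedPreserving_ofPlane μ
  have hw' : Measurable fun g : AffineLineGroup => ((c⁻¹ * |(g.a : ℝ)| : ℝ) : ℂ) := by
    have : Continuous fun g : AffineLineGroup => ((c⁻¹ * |(g.a : ℝ)| : ℝ) : ℂ) := by fun_prop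
    exact this.measurable
  refine ⟨h.weightedEquiv measurable_toPlane hw' ?_, fun g F => ?_⟩
  · filter_upwards [ae_snd_ne_zero] with p hp
    refine ⟨?_, toPlane_ofPlane hp⟩
    have ha : ((ofPlane p).a : ℝ) = p.2 := by simp [ofPlane, hp]
    rw [ha, haarWeight, ← Complex.ofReal_mul, ← Complex.ofReal_mul, ← Complex.ofReal_one]
    congr 1
    have := abs_ne_zero.2 hp
    field_simp
  · change h.weightedComp _ = g.planeRegular (h.weightedComp F)
    refine Lp.ext ((h.weightedComp_ae_of_ae
      (UnitaryRep.leftRegular_apply_ae μ g F)).trans ?_)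
    refine Filter.EventuallyEq.trans ?_ (IsWeightedPreserving.weightedComp_comp_ae _ h F).symm
    filter_upwards [ae_snd_ne_zero] with p hp
    have hmap : Prod.map g.invMap g.dilation.invMap p = g⁻¹.planeMap p := by
      simp only [Prod.map, invMap, dilation, planeMap, inv_x, inv_a, Units.val_inv_eq_inv_val]
      ext <;> simp only <;> ring
    have hfac : ((|((g⁻¹).a : ℝ)|⁻¹ : ℝ) : ℂ) * ((g.factor : ℂ) * (g.factor : ℂ)) = 1 := by
      rw [← pow_two, ← Complex.ofReal_pow, factor_sq, ← Complex.ofReal_mul, inv_a,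
        Units.val_inv_eq_inv_val, abs_inv, inv_inv, mul_inv_cancel₀ (abs_ne_zero.2 g.a.ne_zero),
        Complex.ofReal_one]
    rw [hmap, haarWeight_planeMap, ← mul_ofPlane g⁻¹ hp, factor_dilation]
    linear_combination -(c * haarWeight p * F (g⁻¹ * ofPlane p)) * hfac

/-- `P` is the Fourier transform in the first variable, realised by matching two Hilbert sum
decompositions of the same space, with summands f ⊗ b_j and f̂ ⊗ b_j. -/
theorem exists_partialFourier (b : HilbertBasis ℕ ℂ (Lp ℂ 2 (volume : Measure ℝ))) :
    ∃ P : Lp ℂ 2 planeVolume ≃ₗᵢ[ℂ] Lp ℂ 2 planeVolume, ∀ (g : AffineLineGroup) F,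
      P (g.planeRegular F) = g.planeDual (P F) := by
  have hA := isHilbertSum_tensor (μ := (volume : Measure ℝ)) b (LinearIsometryEquiv.refl ℂ _)
  have hB := isHilbertSum_tensor (μ := (volume : Measure ℝ)) b fourierL2
  set P := hA.linearIsometryEquiv.trans hB.linearIsometryEquiv.symm with hP
  have hbasis : ∀ j f, P (tensorLp f (b j)) = tensorLp (fourierL2 f) (b j) := by
    intro j f
    have h1 := hA.linearIsometryEquiv_symm_apply_single (i := j) f
    have h2 := hB.linearIsometryEquiv_symm_apply_single (i := j) f
    have h3 : tensorLp f (b j) = hA.linearIsometryEquiv.symm (lp.single 2 j f) := h1.symm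
    rw [h3, hP, LinearIsometryEquiv.trans_apply, LinearIsometryEquiv.apply_symm_apply, h2]
    rfl
  -- Basis vectors in the second slot are not enough for the intertwining relation: ρ[0, a] moves `b
  -- j` to a vector that need not belong to the basis.
  have htensor : ∀ f k, P (tensorLp f k) = tensorLp (fourierL2 f) k := by
    intro f k
    have h := b.ext_continuousLinearMap
      (S := (P.toContinuousLinearEquiv : Lp ℂ 2 planeVolume →L[ℂ] Lp ℂ 2 planeVolume).comp
        (tensorCLM f))
      (T := tensorCLM (fourierL2 f)) fun j => hbasis j f
    exact DFunLike.congr_fun h k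
  refine ⟨P, fun g F => ?_⟩
  have h := hA.ext_continuousLinearMap
    (S := (P.toContinuousLinearEquiv : Lp ℂ 2 planeVolume →L[ℂ] Lp ℂ 2 planeVolume).comp
      g.planeRegular.toContinuousLinearMap)
    (T := g.planeDual.toContinuousLinearMap.comp
      (P.toContinuousLinearEquiv : Lp ℂ 2 planeVolume →L[ℂ] Lp ℂ 2 planeVolume)) fun j f => by
    change P (g.planeRegular (tensorLp f (b j))) = g.planeDual (P (tensorLp f (b j)))
    rw [htensor, planeRegular_tensorLp, planeDual_tensorLp, htensor]
  exact DFunLike.congr_fun h F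

/-- The map `(ξ, c) ↦ (ξ, c / ξ)` with weight `|ξ|^{-1/2}` preserves Lebesgue measure. -/
theorem isWeightedPreserving_shear :
    IsWeightedPreserving (fun p : ℝ × ℝ => (p.1, p.2 * p.1⁻¹))
      (fun p => ((|p.1| ^ (-(1 / 2) : ℝ) : ℝ) : ℂ)) planeVolume planeVolume where
  measurable_map := by fun_prop
  measurable_weight := by fun_prop
  map_eq := by
    have hψ : Measurable fun p : ℝ × ℝ => (p.1, p.2 * p.1⁻¹) := by fun_prop
    have hw : ∀ ξ : ℝ, ‖((|ξ| ^ (-(1 / 2) : ℝ) : ℝ) : ℂ)‖ₑ ^ 2 = ENNReal.ofReal |ξ|⁻¹ := by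
      intro ξ
      rw [← ofReal_norm, Complex.norm_real, Real.norm_of_nonneg (by positivity),
        ← ENNReal.ofReal_pow (by positivity), ← Real.rpow_natCast, ← Real.rpow_mul (abs_nonneg _),
        ← Real.rpow_neg_one]
      norm_num
    have hm : Measurable fun p : ℝ × ℝ => ENNReal.ofReal |p.1|⁻¹ := by fun_prop
    simp only [hw]
    ext s hs
    rw [Measure.map_apply hψ hs, withDensity_apply _ (hψ hs), ← lintegral_indicator (hψ hs),
      lintegral_prod _ (hm.indicator (hψ hs)).aemeasurable, Measure.prod_apply hs]
    refine lintegral_congr_ae ?_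
    filter_upwards [Measure.ae_ne volume (0 : ℝ)] with ξ hξ
    have h1 : ∀ c : ℝ, ((fun p : ℝ × ℝ => (p.1, p.2 * p.1⁻¹)) ⁻¹' s).indicator
        (fun p => ENNReal.ofReal |p.1|⁻¹) (ξ, c) =
        ((fun c => c * ξ⁻¹) ⁻¹' (Prod.mk ξ ⁻¹' s)).indicator
          (fun _ => ENNReal.ofReal |ξ|⁻¹) c := fun c => rfl
    simp only [h1]
    rw [lintegral_indicator_const
      ((measurable_mul_const ξ⁻¹) (measurable_prodMk_left hs)),
      Real.volume_preimage_mul_right (inv_ne_zero hξ), inv_inv, ← mul_assoc,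
      ← ENNReal.ofReal_mul (by positivity), inv_mul_cancel₀ (abs_ne_zero.2 hξ), ENNReal.ofReal_one,
      one_mul]

/-- `W` passes to the invariant coordinate c = ξb. Its weight absorbs the normalisation of ρ[0, a],
since |a|^{-1/2} |ξ|^{-1/2} = |aξ|^{-1/2}, so nothing acts on c any more. -/
theorem exists_unitary_planeDual :
    ∃ W : Lp ℂ 2 planeVolume ≃ₗᵢ[ℂ] Lp ℂ 2 planeVolume, ∀ (g : AffineLineGroup) F,
      W (g.planeDual F) = g.planeDualOne (W F) := by
  have h := isWeightedPreserving_shear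
  refine ⟨h.weightedEquiv (φ' := fun p => (p.1, p.2 * p.1))
    (w' := fun p => ((|p.1| ^ (1 / 2 : ℝ) : ℝ) : ℂ)) (by fun_prop) (by fun_prop) ?_,
    fun g F => ?_⟩
  · filter_upwards [ae_fst_ne_zero] with p hp
    constructor
    · rw [← Complex.ofReal_mul, ← Real.rpow_add (abs_pos.2 hp)]
      simp
    · ext
      · rfl
      · simp [hp]
  · change h.weightedComp _ = g.planeDualOne (h.weightedComp F)
    refine Lp.ext ((IsWeightedPreserving.weightedComp_comp_ae h _ F).trans ?_)
    -- The identity holds even at ξ = 0, with the convention 0⁻¹ = 0.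
    refine Filter.EventuallyEq.trans (.of_forall fun p => ?_)
      (IsWeightedPreserving.weightedComp_comp_ae _ h F).symm
    have h1 : Prod.map (fun ξ : ℝ => g.a * ξ) g.dilation.invMap (p.1, p.2 * p.1⁻¹) =
        ((g.a : ℝ) * p.1, p.2 * ((g.a : ℝ) * p.1)⁻¹) := by
      simp only [Prod.map, invMap, dilation, mul_inv]
      refine Prod.ext rfl ?_
      simp only
      ring
    have h2 : g.dilation.a = g.a := rfl
    simp only [h1, h2, Prod.map_fst, Prod.map_snd, id, abs_mul,
      Real.mul_rpow (abs_nonneg (g.a : ℝ)) (abs_nonneg p.1), factor]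
    push_cast
    ring

theorem natural_multiple_equivalent (μ : Measure AffineLineGroup) [μ.IsHaarMeasure] :
    (UnitaryRep.leftRegular μ).Equivalent (natural.multiple ℕ) := by
  have : Fact ((2 : ℝ≥0∞) ≠ ∞) := ⟨by norm_num⟩
  obtain ⟨b⟩ := exists_hilbertBasis_nat not_finiteDimensional_L2_real
  obtain ⟨U, hU⟩ := exists_unitary_leftRegular μ
  obtain ⟨P, hP⟩ := exists_partialFourier b
  obtain ⟨W, hW⟩ := exists_unitary_planeDual
  -- The summands sit in L²(ℝ²) as f ↦ f̂ ⊗ b_j, so that ρ̂(g) ⊗ 1 restricts to ρ(g) itself on each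
  -- of them.
  have hB := isHilbertSum_tensor (μ := (volume : Measure ℝ)) b fourierL2
  set B := hB.linearIsometryEquiv
  have hN : ∀ (g : AffineLineGroup) ξ,
      g.planeDualOne (B.symm ξ) = B.symm ((natural.multiple ℕ).toHom g ξ) := by
    intro g ξ
    have h1 := (hB.hasSum_linearIsometryEquiv_symm ξ).mapL g.planeDualOne.toContinuousLinearMap
    refine h1.unique ?_
    convert hB.hasSum_linearIsometryEquiv_symm ((natural.multiple ℕ).toHom g ξ) using 2 with j
    change g.planeDualOne (tensorLp (fourierL2 (ξ j)) (b j)) =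
      tensorLp (fourierL2 (g.naturalMap (ξ j))) (b j)
    exact g.planeDualOne_tensorLp _ _
  refine ⟨U.trans (P.trans (W.trans B)), fun g F => ?_⟩
  simp only [LinearIsometryEquiv.trans_apply]
  apply B.symm.injective
  rw [hU, hP, hW, ← hN, B.symm_apply_apply, B.symm_apply_apply]

end AffineLineGroup

end

theorem mainTheorem8 (μ : MeasureTheory.Measure AffineLineGroup) [μ.IsHaarMeasure] :
    (UnitaryRep.leftRegular μ).Equivalent (AffineLineGroup.natural.multiple ℕ) ∧
      AffineLineGroup.natural.IsSquareIntegrable μ :=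
  ⟨AffineLineGroup.natural_multiple_equivalent μ, AffineLineGroup.natural_isSquareIntegrable μ⟩
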